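/- For $\sigma\ge 0$ let $H^\sigma(\mathbb{R}^d)$ be the $L^2$-based Sobolev space with norm $\|u\|_{H^\sigma}=\|(I-\Delta)^{\sigma/2}u\|_{L^2}$. For a vector field $v=(v_1,\dots,v_d)$ on $\mathbb{R}^d$ write $\nabla v=(\partial_i v_j)_{i,j}$, $\operatorname{div} v=\sum_i\partial_i v_i$ and $\operatorname{curl} v=(\partial_i v_j-\partial_j v_i)_{i<j}$ (so $\operatorname{curl} v=0$ if $d=1$), derivatives being taken in the sense of distributions; the $H^\sigma$ norm of a family is the square root of the sum of the squares of the norms of its entries. All functions and vector fields are real valued. (1) Let $d\ge 3$ and let $s>d/2$ be an integer. There exists a function $\mathcal{C}:[0,\infty)^2\to\mathbb{R}$, nondecreasing in each variable and depending only on $d$ and $s$, such that for all $\varphi\in H^{s+1}(\mathbb{R}^d)$ and all vector fields $v\in H^{s+1}(\mathbb{R}^d)$ one has $\nabla\varphi\in L^\infty$, $e^{\varphi}v\in H^{s+1}(\mathbb{R}^d)$ and $$\|\nabla v\|_{H^s}\le C\,\|\operatorname{div}(e^{\varphi}v)\|_{H^s}+C\,\|\operatorname{curl} v\|_{H^s},\qquad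 C:=(1+\|\varphi\|_{H^{s+1}})\,\mathcal{C}\bigl(\|\varphi\|_{H^s},\|\nabla\varphi\|_{L^\infty}\bigr).$$ (2) Let $d=1$ or $d\ge 3$ and let $s>d/2$ be an integer. There exists a nondecreasing function $\mathcal{C}:[0,\infty)\to\mathbb{R}$, depending only on $d$ and $s$, such that for all $\varphi\in H^{s+1}(\mathbb{R}^d)$ and all vector fields $v\in H^{s+1}(\mathbb{R}^d)$ one has $e^{\varphi}v\in H^{s+1}(\mathbb{R}^d)$ and $$\|\nabla v\|_{H^s}\le \mathcal{C}\bigl(\|\varphi\|_{H^{s+1}}\bigr)\bigl(\|\operatorname{div} v\|_{H^s}+\|\operatorname{curl}(e^{\varphi}v)\|_{H^s}\bigr).$$ -/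

import Mathlib

open MeasureTheory TemperedDistribution
open scoped SchwartzMap LineDeriv ENNReal

noncomputable section

namespace WeightedFriedrichs

/-- The Euclidean space `ℝ^d`. -/
abbrev E (d : ℕ) : Type := EuclideanSpace ℝ (Fin d)

/-- The `i`-th vector of the canonical basis of `ℝ^d`. -/
def e {d : ℕ} (i : Fin d) : E d := EuclideanSpace.single i (1 : ℝ)

open Classical in
/-- The tempered distribution `g ↦ ∫ f g` given by a square integrable function `f` (and `0` for a
function which is not square integrable). -/
def toDist {d : ℕ} (f : E d → ℂ) : 𝓢'(E d, ℂ) :=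
  if h : MemLp f 2 volume then ((h.toLp f : Lp ℂ 2 (volume : Measure (E d))) : 𝓢'(E d, ℂ)) else 0

/-- The symbol `(1 + |2πξ|²)^{σ/2}` of `(I - Δ)^{σ/2}`; with Mathlib's convention
`𝓕 f (ξ) = ∫ e^{-2πi⟨x,ξ⟩} f(x) dx`, the symbol of `-Δ` is `|2πξ|²`. -/
def besselSymbol (d : ℕ) (σ : ℝ) (ξ : E d) : ℂ :=
  (((1 + ‖(2 * Real.pi) • ξ‖ ^ 2) ^ (σ / 2) : ℝ) : ℂ)

/-- The operator `(I - Δ)^{σ/2}` on tempered distributions. -/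
def bessel {d : ℕ} (σ : ℝ) : 𝓢'(E d, ℂ) →L[ℂ] 𝓢'(E d, ℂ) :=
  fourierMultiplierCLM ℂ (besselSymbol d σ)

open Classical in
/-- The norm `‖u‖_{H^σ} = ‖(I - Δ)^{σ/2} u‖_{L²}` (and `0` if `u ∉ H^σ`). -/
def sobolevNorm {d : ℕ} (σ : ℝ) (u : 𝓢'(E d, ℂ)) : ℝ :=
  if h : ∃ f : Lp ℂ 2 (volume : Measure (E d)), bessel σ u = (f : 𝓢'(E d, ℂ)) then ‖h.choose‖ else 0

theorem sobolevNorm_eq {d : ℕ} {σ : ℝ} {u : 𝓢'(E d, ℂ)} {f : Lp ℂ 2 (volume : Measure (E d))}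
    (hf : bessel σ u = (f : 𝓢'(E d, ℂ))) : sobolevNorm σ u = ‖f‖ := by
  have h : ∃ f : Lp ℂ 2 (volume : Measure (E d)), bessel σ u = (f : 𝓢'(E d, ℂ)) := ⟨f, hf⟩
  have hc : h.choose = f := by
    have h1 : Lp.toTemperedDistributionCLM ℂ volume 2 h.choose
        = Lp.toTemperedDistributionCLM ℂ volume 2 f := by
      rw [Lp.toTemperedDistributionCLM_apply, Lp.toTemperedDistributionCLM_apply,
        ← h.choose_spec, hf]
    exact LinearMap.ker_eq_bot.mp Lp.ker_toTemperedDistributionCLM_eq_bot h1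
  rw [sobolevNorm, dif_pos h, hc]

theorem besselSymbol_hasTemperateGrowth (d : ℕ) (σ : ℝ) :
    (besselSymbol d σ).HasTemperateGrowth := by
  have h1 := Function.hasTemperateGrowth_one_add_norm_sq_rpow (E d) (σ / 2)
  have h2 : (fun ξ : E d ↦ (2 * Real.pi) • ξ).HasTemperateGrowth := by fun_prop
  have h3 := h1.comp h2
  unfold besselSymbol
  fun_prop

theorem ratio_rpow_le {t p : ℝ} (ht : 0 ≤ t) :
    (1 + (2 * Real.pi) ^ 2 * t) ^ p * (1 + t) ^ (-p) ≤ ((2 * Real.pi) ^ 2) ^ |p| ∧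
    (1 + (2 * Real.pi) ^ 2 * t) ^ (-p) * (1 + t) ^ p ≤ ((2 * Real.pi) ^ 2) ^ |p| := by
  have hc : (1 : ℝ) ≤ (2 * Real.pi) ^ 2 := by nlinarith [Real.pi_gt_three]
  generalize (2 * Real.pi) ^ 2 = c at hc
  have h0 : (0 : ℝ) < 1 + t := by positivity
  have h1 : (0 : ℝ) < 1 + c * t := by positivity
  have hr : 1 ≤ (1 + c * t) / (1 + t) := by rw [le_div_iff₀ h0]; nlinarith
  have hr' : (1 + c * t) / (1 + t) ≤ c := by rw [div_le_iff₀ h0]; nlinarith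
  have key : ∀ q : ℝ, |q| = |p| → (1 + c * t) ^ q * (1 + t) ^ (-q) ≤ c ^ |p| := by
    intro q hq
    rw [Real.rpow_neg h0.le, ← div_eq_mul_inv, ← Real.div_rpow h1.le h0.le, ← hq]
    calc ((1 + c * t) / (1 + t)) ^ q ≤ ((1 + c * t) / (1 + t)) ^ |q| :=
          Real.rpow_le_rpow_of_exponent_le hr (le_abs_self q)
      _ ≤ c ^ |q| := Real.rpow_le_rpow (by linarith) hr' (abs_nonneg q)
  exact ⟨key p rfl, by simpa using key (-p) (abs_neg p)⟩

/-- The distributions for which `sobolevNorm σ` takes its genuine value are exactly the elements of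
Mathlib's Sobolev space of order `σ`. -/
theorem memSobolev_iff_bessel {d : ℕ} (σ : ℝ) (u : 𝓢'(E d, ℂ)) :
    MemSobolev σ 2 u ↔ ∃ f : Lp ℂ 2 (volume : Measure (E d)), bessel σ u = (f : 𝓢'(E d, ℂ)) := by
  have hB := besselSymbol_hasTemperateGrowth d
  have hM : ∀ τ : ℝ, (fun x : E d ↦ (((1 + ‖x‖ ^ 2) ^ (τ / 2) : ℝ) : ℂ)).HasTemperateGrowth :=
    fun τ ↦ by fun_prop
  have hnorm : ∀ ξ : E d, ‖(2 * Real.pi) • ξ‖ ^ 2 = (2 * Real.pi) ^ 2 * ‖ξ‖ ^ 2 := by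
    intro ξ
    rw [norm_smul, mul_pow, Real.norm_eq_abs, sq_abs]
  constructor
  · intro h
    rw [← memSobolev_zero_iff]
    have h0 : MemSobolev 0 2 (besselPotential (E d) ℂ σ u) := by
      rw [memSobolev_besselPotential_iff]; simpa using h
    have h1 := h0.fourierMultiplierCLM_of_bounded (g := besselSymbol d σ *
      fun x ↦ (((1 + ‖x‖ ^ 2) ^ (-σ / 2) : ℝ) : ℂ)) ((hB σ).mul (hM (-σ)))
      ⟨((2 * Real.pi) ^ 2) ^ |σ / 2|, fun x ↦ ?_⟩
    · rw [besselPotential, fourierMultiplierCLM_fourierMultiplierCLM_apply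
        (hM σ) ((hB σ).mul (hM (-σ)))] at h1
      have hs : (fun x : E d ↦ (((1 + ‖x‖ ^ 2) ^ (σ / 2) : ℝ) : ℂ)) * (besselSymbol d σ *
          fun x ↦ (((1 + ‖x‖ ^ 2) ^ (-σ / 2) : ℝ) : ℂ)) = besselSymbol d σ := by
        ext x
        simp only [Pi.mul_apply]
        rw [mul_left_comm, ← Complex.ofReal_mul, ← Real.rpow_add (by positivity)]
        ring_nf
        simp
      rwa [hs] at h1
    · have := (ratio_rpow_le (t := ‖x‖ ^ 2) (p := σ / 2) (by positivity)).1
      simp only [Pi.mul_apply, besselSymbol, hnorm]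
      rw [← Complex.ofReal_mul, Complex.norm_real, Real.norm_eq_abs, abs_of_nonneg (by positivity)]
      rwa [neg_div]
  · intro h
    rw [← memSobolev_zero_iff] at h
    have h1 := h.fourierMultiplierCLM_of_bounded (g := besselSymbol d (-σ) *
      fun x ↦ (((1 + ‖x‖ ^ 2) ^ (σ / 2) : ℝ) : ℂ)) ((hB (-σ)).mul (hM σ))
      ⟨((2 * Real.pi) ^ 2) ^ |σ / 2|, fun x ↦ ?_⟩
    · rw [bessel, fourierMultiplierCLM_fourierMultiplierCLM_apply
        (hB σ) ((hB (-σ)).mul (hM σ))] at h1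
      have hs : besselSymbol d σ * (besselSymbol d (-σ) *
          fun x ↦ (((1 + ‖x‖ ^ 2) ^ (σ / 2) : ℝ) : ℂ)) =
          fun x : E d ↦ (((1 + ‖x‖ ^ 2) ^ (σ / 2) : ℝ) : ℂ) := by
        ext x
        simp only [Pi.mul_apply, besselSymbol]
        rw [← mul_assoc, ← Complex.ofReal_mul, ← Real.rpow_add (by positivity)]
        ring_nf
        simp
      rw [hs] at h1
      have h2 : MemSobolev 0 2 (besselPotential (E d) ℂ σ u) := h1
      rw [memSobolev_besselPotential_iff] at h2
      simpa using h2
    · have := (ratio_rpow_le (t := ‖x‖ ^ 2) (p := σ / 2) (by positivity)).2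
      simp only [Pi.mul_apply, besselSymbol, hnorm]
      rw [← Complex.ofReal_mul, Complex.norm_real, Real.norm_eq_abs, abs_of_nonneg (by positivity)]
      rwa [neg_div]

/-- A real function belongs to `H^σ(ℝ^d)` (`σ ≥ 0`). -/
def MemH {d : ℕ} (σ : ℝ) (f : E d → ℝ) : Prop :=
  MemLp f 2 volume ∧ MemSobolev σ 2 (toDist fun x ↦ (f x : ℂ))

/-- A real vector field belongs to `H^σ(ℝ^d)` (`σ ≥ 0`). -/
def VecMemH {d : ℕ} (σ : ℝ) (v : E d → E d) : Prop :=
  ∀ i, MemH σ fun x ↦ v x i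

/-- The distributional derivative `∂_i v_j` of a square integrable vector field. -/
def pd {d : ℕ} (v : E d → E d) (i j : Fin d) : 𝓢'(E d, ℂ) :=
  ∂_{e i} (toDist fun x ↦ (v x j : ℂ))

/-- `‖f‖_{H^σ}` for a real function. -/
def normH {d : ℕ} (σ : ℝ) (f : E d → ℝ) : ℝ :=
  sobolevNorm σ (toDist fun x ↦ (f x : ℂ))

/-- `‖∇v‖_{H^σ}`, where `∇v = (∂_i v_j)_{i,j}`. -/
def normGrad {d : ℕ} (σ : ℝ) (v : E d → E d) : ℝ :=
  Real.sqrt (∑ i, ∑ j, sobolevNorm σ (pd v i j) ^ 2)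

/-- `‖div v‖_{H^σ}`. -/
def normDiv {d : ℕ} (σ : ℝ) (v : E d → E d) : ℝ :=
  sobolevNorm σ (∑ i, pd v i i)

/-- `‖curl v‖_{H^σ}`, where `curl v = (∂_i v_j - ∂_j v_i)_{i<j}`. -/
def normCurl {d : ℕ} (σ : ℝ) (v : E d → E d) : ℝ :=
  Real.sqrt (∑ j, ∑ i ∈ Finset.univ.filter (· < j), sobolevNorm σ (pd v i j - pd v j i) ^ 2)

/-- `G` is the distributional gradient of the real function `φ`. -/
def IsGradient {d : ℕ} (φ : E d → ℝ) (G : E d → EuclideanSpace ℂ (Fin d)) : Prop :=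
  MemLp G 2 volume ∧ ∀ i, toDist (fun x ↦ G x i) = ∂_{e i} (toDist fun x ↦ (φ x : ℂ))

/-- `‖∇φ‖_{L^∞}`, the essential supremum of `|∇φ|`. The gradient is unique up to null sets; the
value is `∞` if there is no square integrable gradient. -/
def gradSup {d : ℕ} (φ : E d → ℝ) : ℝ≥0∞ :=
  ⨅ (G : E d → EuclideanSpace ℂ (Fin d)) (_ : IsGradient φ G), eLpNorm G ∞ volume

/-- The vector field `e^φ v`. -/
def weighted {d : ℕ} (φ : E d → ℝ) (v : E d → E d) : E d → E d :=
  fun x ↦ Real.exp (φ x) • v x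

end WeightedFriedrichs

end

/-!
For (1), put `α = e^φ - 1` and let `u` be minus the gradient part of `α v`. Then `v - u` has the
divergence of `e^φ v` and the curl of `v`, so the constant-coefficient div-curl estimate controls
`∇(v - u)` in `H^b` for every `b`, and it controls `v - u` in `L^∞` because `|ξ|⁻²` is integrable
at the origin when `d ≥ 3`. As `u + α v` is divergence free and `u` is a gradient,
`⟨(1 + α) u, u⟩ = -⟨α (v - u), u⟩`; since `1 + α = e^φ` is bounded below, this bounds `u` in `L²`.

Interpolating between `L²` and `H^s`, the lower-order term of
`div v = e^{-φ} div (e^φ v) - ∇φ ⬝ v` can be absorbed, which bounds `∇v` first in `H^{s-1}`, with a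
constant depending only on `‖φ‖_{H^s}`. Substituting this bound once more into the identity bounds
`∇v` in `H^s`, now linearly in `‖φ‖_{H^{s+1}}` because the estimates of `e^{±φ} - 1` and of
products are tame.

For (2), apply (1) to `-φ` and `e^φ v`, and write `∇v` in terms of `∇(e^φ v)`. If `d = 1`, then
`∇v = div v`.
-/

open scoped FourierTransform Convolution NNReal

noncomputable section

namespace WeightedFriedrichs

local notation:67 F "⋆ₘ" G:66 => F ⋆[ContinuousLinearMap.mul ℂ ℂ] G

theorem ae_eq_of_forall_integral_schwartz_mul_eq {V : Type*} [NormedAddCommGroup V]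
    [NormedSpace ℝ V] [FiniteDimensional ℝ V] [MeasurableSpace V] [BorelSpace V] {μ : Measure V}
    {f g : V → ℂ} (hf : LocallyIntegrable f μ) (hg : LocallyIntegrable g μ)
    (h : ∀ ψ : 𝓢(V, ℂ), ∫ x, ψ x * f x ∂μ = ∫ x, ψ x * g x ∂μ) : f =ᵐ[μ] g := by
  refine ae_eq_of_integral_contDiff_smul_eq hf hg fun ψ hψ hψc ↦ ?_
  have hc : HasCompactSupport (Complex.ofRealCLM ∘ ψ) := hψc.comp_left rfl
  have hs : ContDiff ℝ (⊤ : ℕ∞) (Complex.ofRealCLM ∘ ψ) := by fun_prop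
  simpa using h (hc.toSchwartzMap hs)

variable {d : ℕ}

theorem toDist_of_memLp {f : E d → ℂ} (hf : MemLp f 2 volume) :
    toDist f = (hf.toLp f : 𝓢'(E d, ℂ)) := by
  rw [toDist, dif_pos hf]

theorem toDist_apply {f : E d → ℂ} (hf : MemLp f 2 volume) (ψ : 𝓢(E d, ℂ)) :
    toDist f ψ = ∫ x, ψ x * f x := by
  rw [toDist_of_memLp hf, Lp.toTemperedDistribution_apply]
  refine integral_congr_ae ?_
  filter_upwards [hf.coeFn_toLp] with x hx
  rw [hx, smul_eq_mul]

theorem coe_Lp_eq_toDist (f : Lp ℂ 2 (volume : Measure (E d))) :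
    (f : 𝓢'(E d, ℂ)) = toDist f := by
  rw [toDist_of_memLp (Lp.memLp f), Lp.toLp_coeFn]

theorem toDist_add {f g : E d → ℂ} (hf : MemLp f 2 volume) (hg : MemLp g 2 volume) :
    toDist (f + g) = toDist f + toDist g := by
  rw [toDist_of_memLp hf, toDist_of_memLp hg, toDist_of_memLp (hf.add hg), MemLp.toLp_add hf hg]
  exact (Lp.toTemperedDistributionCLM ℂ volume 2).map_add _ _

theorem toDist_smul (c : ℂ) {f : E d → ℂ} (hf : MemLp f 2 volume) :
    toDist (c • f) = c • toDist f := by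
  rw [toDist_of_memLp hf, toDist_of_memLp (hf.const_smul c), MemLp.toLp_const_smul c hf]
  exact (Lp.toTemperedDistributionCLM ℂ volume 2).map_smul _ _

theorem smulLeftCLM_toDist {m F : E d → ℂ} (hm : m.HasTemperateGrowth) (hF : MemLp F 2 volume)
    (ψ : 𝓢(E d, ℂ)) : smulLeftCLM ℂ m (toDist F) ψ = ∫ ξ, ψ ξ * (m ξ * F ξ) := by
  rw [smulLeftCLM_apply_apply, toDist_apply hF]
  refine integral_congr_ae (.of_forall fun ξ ↦ ?_)
  simp only [SchwartzMap.smulLeftCLM_apply_apply hm, smul_eq_mul]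
  ring

/-- `F` represents the `L²` Fourier transform of `f`. -/
structure IsFourierPair (f F : E d → ℂ) : Prop where
  memLp : MemLp f 2 volume
  memLp_fourier : MemLp F 2 volume
  fourier_toLp : 𝓕 (memLp.toLp f) = memLp_fourier.toLp F

namespace IsFourierPair

variable {f g F G : E d → ℂ}

theorem exists_fourier (hf : MemLp f 2 volume) : ∃ F, IsFourierPair f F := by
  refine ⟨(𝓕 (hf.toLp f) : Lp ℂ 2 (volume : Measure (E d))), hf, Lp.memLp _, ?_⟩
  rw [Lp.toLp_coeFn]

theorem exists_fourierInv (hF : MemLp F 2 volume) : ∃ f, IsFourierPair f F := by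
  refine ⟨(𝓕⁻ (hF.toLp F) : Lp ℂ 2 (volume : Measure (E d))), Lp.memLp _, hF, ?_⟩
  rw [Lp.toLp_coeFn, FourierTransform.fourier_fourierInv_eq]

theorem congr (h : IsFourierPair f F) (hf : f =ᵐ[volume] g) (hF : F =ᵐ[volume] G) :
    IsFourierPair g G := by
  refine ⟨h.memLp.ae_eq hf, h.memLp_fourier.ae_eq hF, ?_⟩
  rw [MemLp.toLp_congr (h.memLp.ae_eq hf) h.memLp hf.symm,
    MemLp.toLp_congr (h.memLp_fourier.ae_eq hF) h.memLp_fourier hF.symm, h.fourier_toLp]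

theorem unique (h : IsFourierPair f F) (h' : IsFourierPair f G) : F =ᵐ[volume] G := by
  have := h.fourier_toLp.symm.trans h'.fourier_toLp
  rwa [MemLp.toLp_eq_toLp_iff] at this

theorem add (h : IsFourierPair f F) (h' : IsFourierPair g G) : IsFourierPair (f + g) (F + G) :=
  ⟨h.memLp.add h'.memLp, h.memLp_fourier.add h'.memLp_fourier, by
    rw [MemLp.toLp_add h.memLp h'.memLp, MemLp.toLp_add h.memLp_fourier h'.memLp_fourier,
      FourierTransform.fourier_add, h.fourier_toLp, h'.fourier_toLp]⟩

theorem smul (h : IsFourierPair f F) (c : ℂ) : IsFourierPair (c • f) (c • F) :=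
  ⟨h.memLp.const_smul c, h.memLp_fourier.const_smul c, by
    rw [MemLp.toLp_const_smul c h.memLp, MemLp.toLp_const_smul c h.memLp_fourier,
      FourierTransform.fourier_smul, h.fourier_toLp]⟩

theorem neg (h : IsFourierPair f F) : IsFourierPair (-f) (-F) := by
  simpa using h.smul (-1)

theorem sub (h : IsFourierPair f F) (h' : IsFourierPair g G) : IsFourierPair (f - g) (F - G) := by
  simpa [sub_eq_add_neg] using h.add h'.neg

theorem zero : IsFourierPair (0 : E d → ℂ) 0 :=
  ⟨MemLp.zero, MemLp.zero, by
    rw [MemLp.toLp_zero]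
    exact (Lp.fourierTransformₗᵢ (E d) ℂ).map_zero⟩

theorem sum {ι : Type*} (s : Finset ι) {f F : ι → E d → ℂ}
    (h : ∀ i ∈ s, IsFourierPair (f i) (F i)) : IsFourierPair (∑ i ∈ s, f i) (∑ i ∈ s, F i) := by
  classical
  induction s using Finset.induction_on with
  | empty => simpa using zero
  | insert i s hi ih =>
    rw [Finset.sum_insert hi, Finset.sum_insert hi]
    exact (h i (by simp)).add (ih fun j hj ↦ h j (by simp [hj]))

theorem eLpNorm_eq (h : IsFourierPair f F) : eLpNorm f 2 volume = eLpNorm F 2 volume := by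
  have hnorm := Lp.norm_fourier_eq (h.memLp.toLp f)
  rw [h.fourier_toLp, Lp.norm_toLp, Lp.norm_toLp] at hnorm
  exact ((ENNReal.toReal_eq_toReal_iff' h.memLp_fourier.2.ne h.memLp.2.ne).1 hnorm).symm

end IsFourierPair

theorem integral_mul_conj_eq_inner {f g : E d → ℂ} (hf : MemLp f 2 volume)
    (hg : MemLp g 2 volume) :
    ∫ x, f x * (starRingEnd ℂ) (g x) = inner ℂ (hg.toLp g) (hf.toLp f) := by
  rw [L2.inner_def]
  refine integral_congr_ae ?_
  filter_upwards [hf.coeFn_toLp, hg.coeFn_toLp] with x hfx hgx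
  rw [hfx, hgx]
  rfl

namespace IsFourierPair

variable {f g F G : E d → ℂ}

theorem integral_mul_conj (h : IsFourierPair f F) (h' : IsFourierPair g G) :
    ∫ x, f x * (starRingEnd ℂ) (g x) = ∫ ξ, F ξ * (starRingEnd ℂ) (G ξ) := by
  rw [integral_mul_conj_eq_inner h.memLp h'.memLp,
    integral_mul_conj_eq_inner h.memLp_fourier h'.memLp_fourier, ← h.fourier_toLp,
    ← h'.fourier_toLp, Lp.inner_fourier_eq]

theorem fourier_toDist (h : IsFourierPair f F) : 𝓕 (toDist f) = toDist F := by
  rw [toDist_of_memLp h.memLp, Lp.fourier_toTemperedDistribution_eq, h.fourier_toLp,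
    toDist_of_memLp h.memLp_fourier]

theorem toDist_eq_fourierInv (h : IsFourierPair f F) : toDist f = 𝓕⁻ (toDist F) := by
  rw [← h.fourier_toDist]
  exact (FourierTransform.fourierInv_fourier_eq _).symm

theorem integral_schwartz_mul (h : IsFourierPair f F) (ψ : 𝓢(E d, ℂ)) :
    ∫ x, ψ x * F x = ∫ x, (𝓕 ψ : 𝓢(E d, ℂ)) x * f x := by
  rw [← toDist_apply h.memLp_fourier, ← h.fourier_toDist, TemperedDistribution.fourier_apply,
    toDist_apply h.memLp]

theorem exists_fourierMultiplier_eq (h : IsFourierPair f F) {m : E d → ℂ}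
    (hm : m.HasTemperateGrowth) (hmF : MemLp (fun ξ ↦ m ξ * F ξ) 2 volume) :
    ∃ k, IsFourierPair k (fun ξ ↦ m ξ * F ξ) ∧
      fourierMultiplierCLM ℂ m (toDist f) = toDist k := by
  obtain ⟨k, hk⟩ := exists_fourierInv hmF
  refine ⟨k, hk, ?_⟩
  rw [fourierMultiplierCLM_apply, h.fourier_toDist, hk.toDist_eq_fourierInv]
  congr 1
  ext ψ
  rw [smulLeftCLM_toDist hm h.memLp_fourier, toDist_apply hmF]

theorem memLp_of_fourierMultiplier_eq (h : IsFourierPair f F) {m : E d → ℂ}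
    (hm : m.HasTemperateGrowth) {k : Lp ℂ 2 (volume : Measure (E d))}
    (hk : fourierMultiplierCLM ℂ m (toDist f) = (k : 𝓢'(E d, ℂ))) :
    MemLp (fun ξ ↦ m ξ * F ξ) 2 volume := by
  obtain ⟨K, hK⟩ := exists_fourier (Lp.memLp k)
  have hdist : smulLeftCLM ℂ m (toDist F) = toDist K := by
    rw [← hK.fourier_toDist, ← coe_Lp_eq_toDist, ← hk, fourierMultiplierCLM_apply,
      h.fourier_toDist, FourierTransform.fourier_fourierInv_eq]
  have hmF : LocallyIntegrable (fun ξ ↦ m ξ * F ξ) := by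
    simpa using! (h.memLp_fourier.locallyIntegrable (by norm_num)).continuous_smul
      (g := m) hm.1.continuous
  refine hK.memLp_fourier.ae_eq (ae_eq_of_forall_integral_schwartz_mul_eq
    (hK.memLp_fourier.locallyIntegrable (by norm_num)) hmF fun ψ ↦ ?_)
  rw [← smulLeftCLM_toDist hm h.memLp_fourier, hdist, toDist_apply hK.memLp_fourier]

theorem ae_eq_fourierInv (h : IsFourierPair f F) (hF : Integrable F) : f =ᵐ[volume] 𝓕⁻ F := by
  have hcont : Continuous (𝓕⁻ F) := by
    rw [← Real.Lp.fourierTransformInv_toLp (memLp_one_iff_integrable.2 hF)]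
    exact ContinuousMapClass.map_continuous _
  refine ae_eq_of_forall_integral_schwartz_mul_eq (h.memLp.locallyIntegrable (by norm_num))
    hcont.locallyIntegrable fun ψ ↦ ?_
  have hL : Continuous fun p : E d × E d ↦ (-innerₗ (E d)) p.1 p.2 := by
    change Continuous fun p : E d × E d ↦ -inner ℝ p.1 p.2
    fun_prop
  have hself := VectorFourier.integral_fourierIntegral_smul_eq_flip
    (μ := volume) (ν := volume)
    Real.continuous_fourierChar hL ψ.integrable hF
  have hflip : (-innerₗ (E d)).flip = -innerₗ (E d) := by
    ext x y
    simp [real_inner_comm]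
  rw [hflip] at hself
  calc ∫ x, ψ x * f x = ∫ ξ, (𝓕⁻ ψ : 𝓢(E d, ℂ)) ξ * F ξ := by
        rw [h.integral_schwartz_mul, FourierTransform.fourier_fourierInv_eq]
    _ = ∫ x, ψ x * 𝓕⁻ F x := by
        rw [SchwartzMap.fourierInv_coe]
        exact hself

theorem ae_norm_le_integral_norm (h : IsFourierPair f F) (hF : Integrable F) :
    ∀ᵐ x, ‖f x‖ ≤ ∫ ξ, ‖F ξ‖ := by
  filter_upwards [h.ae_eq_fourierInv hF] with x hx
  rw [hx, Real.fourierInv_eq]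
  refine (norm_integral_le_integral_norm _).trans_eq ?_
  simp

theorem mul (h : IsFourierPair f F) (h' : IsFourierPair g G) (hF : Integrable F)
    (hG : Integrable G) (hFG : MemLp (F ⋆ₘ G) 2 volume) : IsFourierPair (f * g) (F ⋆ₘ G) := by
  obtain ⟨k, hk⟩ := exists_fourierInv hFG
  refine hk.congr ?_ ae_eq_rfl
  filter_upwards [hk.ae_eq_fourierInv (hF.integrable_convolution _ hG), h.ae_eq_fourierInv hF,
    h'.ae_eq_fourierInv hG] with x hkx hfx hgx
  rw [hkx, Pi.mul_apply, hfx, hgx]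
  simp only [Real.fourierInv_eq_fourier_neg, Real.fourier_mul_convolution_eq hF hG]

theorem toDist_eq (h : IsFourierPair f F) (h' : IsFourierPair g F) : toDist f = toDist g := by
  rw [h.toDist_eq_fourierInv, h'.toDist_eq_fourierInv]

end IsFourierPair

/-- The square `1 + |2πξ|²` of the Japanese bracket, the symbol of `I - Δ`. -/
def bracketSq (ξ : E d) : ℝ := 1 + ‖(2 * Real.pi) • ξ‖ ^ 2

/-- The symbol of `(I - Δ)^{σ/2}` as a real weight; `besselSymbol` is its complex version. -/
def besselWeight (σ : ℝ) (ξ : E d) : ℝ := bracketSq ξ ^ (σ / 2)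

/-- The symbol of `∂_i`. -/
def derivSymbol (i : Fin d) (ξ : E d) : ℂ := 2 * Real.pi * Complex.I * (ξ i : ℂ)

/-- The Fourier side `derivSymbol i • F` of a partial derivative `∂_i`. -/
def derivMul (i : Fin d) (F : E d → ℂ) (ξ : E d) : ℂ := derivSymbol i ξ * F ξ

/-- The `L²` norm with weight `m`. -/
def weightedNorm (m : E d → ℝ) (F : E d → ℂ) : ℝ≥0∞ :=
  eLpNorm (fun ξ ↦ (m ξ : ℂ) * F ξ) 2 volume

/-- The distribution `u` is a square integrable function whose Fourier transform is `F`. -/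
def HasL2Fourier (u : 𝓢'(E d, ℂ)) (F : E d → ℂ) : Prop := ∃ f, IsFourierPair f F ∧ u = toDist f

theorem IsFourierPair.hasL2Fourier {f F : E d → ℂ} (h : IsFourierPair f F) :
    HasL2Fourier (toDist f) F :=
  ⟨f, h, rfl⟩

namespace HasL2Fourier

variable {u w : 𝓢'(E d, ℂ)} {F G : E d → ℂ}

theorem add (h : HasL2Fourier u F) (h' : HasL2Fourier w G) : HasL2Fourier (u + w) (F + G) := by
  obtain ⟨f, hf, rfl⟩ := h
  obtain ⟨g, hg, rfl⟩ := h'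
  exact ⟨f + g, hf.add hg, (toDist_add hf.memLp hg.memLp).symm⟩

theorem smul (h : HasL2Fourier u F) (c : ℂ) : HasL2Fourier (c • u) (c • F) := by
  obtain ⟨f, hf, rfl⟩ := h
  exact ⟨c • f, hf.smul c, (toDist_smul c hf.memLp).symm⟩

theorem sub (h : HasL2Fourier u F) (h' : HasL2Fourier w G) : HasL2Fourier (u - w) (F - G) := by
  have hsum := h.add (h'.smul (-1))
  rwa [neg_one_smul ℂ w, neg_one_smul ℂ G, ← sub_eq_add_neg, ← sub_eq_add_neg] at hsum

theorem zero : HasL2Fourier (0 : 𝓢'(E d, ℂ)) 0 := by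
  have hsmul := (IsFourierPair.zero (d := d)).hasL2Fourier.smul 0
  rwa [zero_smul ℂ (toDist (0 : E d → ℂ)), smul_zero] at hsmul

theorem sum {ι : Type*} (s : Finset ι) {u : ι → 𝓢'(E d, ℂ)} {F : ι → E d → ℂ}
    (h : ∀ i ∈ s, HasL2Fourier (u i) (F i)) : HasL2Fourier (∑ i ∈ s, u i) (∑ i ∈ s, F i) := by
  classical
  induction s using Finset.induction_on with
  | empty => simpa using zero
  | insert i s hi ih =>
    rw [Finset.sum_insert hi, Finset.sum_insert hi]
    exact (h i (by simp)).add (ih fun j hj ↦ h j (by simp [hj]))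

theorem sobolevNorm_eq (h : HasL2Fourier u F) {σ : ℝ}
    (hF : MemLp (fun ξ ↦ (besselWeight σ ξ : ℂ) * F ξ) 2 volume) :
    sobolevNorm σ u = (weightedNorm (besselWeight σ) F).toReal := by
  obtain ⟨f, hf, rfl⟩ := h
  obtain ⟨k, hk, hmul⟩ := hf.exists_fourierMultiplier_eq (besselSymbol_hasTemperateGrowth d σ) hF
  rw [toDist_of_memLp hk.memLp] at hmul
  rw [WeightedFriedrichs.sobolevNorm_eq hmul, Lp.norm_toLp, hk.eLpNorm_eq]
  rfl

theorem memSobolev_iff (h : HasL2Fourier u F) {σ : ℝ} :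
    MemSobolev σ 2 u ↔ MemLp (fun ξ ↦ (besselWeight σ ξ : ℂ) * F ξ) 2 volume := by
  obtain ⟨f, hf, rfl⟩ := h
  rw [memSobolev_iff_bessel]
  constructor
  · rintro ⟨k, hk⟩
    exact hf.memLp_of_fourierMultiplier_eq (besselSymbol_hasTemperateGrowth d σ) hk
  · intro hF
    obtain ⟨k, hk, hmul⟩ :=
      hf.exists_fourierMultiplier_eq (besselSymbol_hasTemperateGrowth d σ) hF
    rw [toDist_of_memLp hk.memLp] at hmul
    exact ⟨_, hmul⟩

theorem lineDeriv (h : HasL2Fourier u F) (i : Fin d) (hF : MemLp (derivMul i F) 2 volume) :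
    HasL2Fourier (∂_{e i} u) (derivMul i F) := by
  obtain ⟨f, hf, rfl⟩ := h
  have hinner : ∀ ξ : E d, inner ℝ ξ (e i) = ξ i := fun ξ ↦ by
    simp [e, EuclideanSpace.inner_single_right]
  have hF' : MemLp (fun ξ : E d ↦ ((inner ℝ ξ (e i) : ℝ) : ℂ) * F ξ) 2 volume := by
    convert! hF.const_mul (2 * Real.pi * Complex.I)⁻¹ using 2 with ξ
    rw [hinner, derivMul, derivSymbol]
    field_simp [Real.pi_ne_zero, Complex.I_ne_zero]
  obtain ⟨k, hk, hmul⟩ := hf.exists_fourierMultiplier_eq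
    (m := fun ξ ↦ ((inner ℝ ξ (e i) : ℝ) : ℂ)) (by fun_prop) hF'
  rw [lineDeriv_eq_fourierMultiplierCLM, hmul]
  convert hk.hasL2Fourier.smul (2 * Real.pi * Complex.I) using 1
  ext ξ
  simp only [Pi.smul_apply, smul_eq_mul, hinner, derivMul, derivSymbol]
  ring

end HasL2Fourier

theorem one_le_bracketSq (ξ : E d) : 1 ≤ bracketSq ξ :=
  le_add_of_nonneg_right (sq_nonneg _)

theorem bracketSq_pos (ξ : E d) : 0 < bracketSq ξ := zero_lt_one.trans_le (one_le_bracketSq ξ)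

theorem besselWeight_pos (σ : ℝ) (ξ : E d) : 0 < besselWeight σ ξ :=
  Real.rpow_pos_of_pos (bracketSq_pos ξ) _

theorem besselWeight_sq (σ : ℝ) (ξ : E d) : besselWeight σ ξ ^ 2 = bracketSq ξ ^ σ := by
  rw [besselWeight, ← Real.rpow_mul_natCast (bracketSq_pos ξ).le]
  congr 1
  push_cast
  ring

theorem besselWeight_zero (ξ : E d) : besselWeight 0 ξ = 1 := by simp [besselWeight]

theorem besselWeight_add (a b : ℝ) (ξ : E d) :
    besselWeight (a + b) ξ = besselWeight a ξ * besselWeight b ξ := by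
  rw [besselWeight, add_div, Real.rpow_add (bracketSq_pos ξ)]
  rfl

theorem besselWeight_mono {a b : ℝ} (hab : a ≤ b) (ξ : E d) :
    besselWeight a ξ ≤ besselWeight b ξ :=
  Real.rpow_le_rpow_of_exponent_le (one_le_bracketSq ξ) (by linarith)

theorem besselWeight_one (ξ : E d) : besselWeight 1 ξ = √(bracketSq ξ) :=
  (Real.sqrt_eq_rpow _).symm

@[fun_prop]
theorem measurable_besselWeight (σ : ℝ) : Measurable (besselWeight σ : E d → ℝ) := by
  unfold besselWeight bracketSq; fun_prop

theorem bracketSq_le_four_mul_max (ξ t : E d) :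
    bracketSq ξ ≤ 4 * max (bracketSq t) (bracketSq (ξ - t)) := by
  have triangle : ‖(2 * Real.pi) • ξ‖ ≤ ‖(2 * Real.pi) • t‖ + ‖(2 * Real.pi) • (ξ - t)‖ := by
    refine le_trans (le_of_eq ?_) (norm_add_le _ _)
    rw [← smul_add, add_sub_cancel]
  have hle : bracketSq ξ ≤ 2 * bracketSq t + 2 * bracketSq (ξ - t) := by
    unfold bracketSq
    nlinarith [norm_nonneg ((2 * Real.pi) • ξ),
      sq_nonneg (‖(2 * Real.pi) • t‖ - ‖(2 * Real.pi) • (ξ - t)‖)]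
  linarith [le_max_left (bracketSq t) (bracketSq (ξ - t)),
    le_max_right (bracketSq t) (bracketSq (ξ - t))]

theorem besselWeight_one_le (ξ t : E d) :
    besselWeight 1 ξ ≤ 2 * (besselWeight 1 t + besselWeight 1 (ξ - t)) := by
  simp only [besselWeight_one]
  have ht := Real.sqrt_nonneg (bracketSq t)
  have hs := Real.sqrt_nonneg (bracketSq (ξ - t))
  refine Real.sqrt_le_iff.2 ⟨by positivity, (bracketSq_le_four_mul_max ξ t).trans ?_⟩
  rw [mul_pow]
  have : max (bracketSq t) (bracketSq (ξ - t)) ≤ (√(bracketSq t) + √(bracketSq (ξ - t))) ^ 2 :=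
    max_le (by nlinarith [Real.sq_sqrt (bracketSq_pos t).le])
      (by nlinarith [Real.sq_sqrt (bracketSq_pos (ξ - t)).le])
  linarith

theorem integrable_bracketSq_rpow {b : ℝ} (hb : (d : ℝ) / 2 < b) :
    Integrable fun ξ : E d ↦ bracketSq ξ ^ (-b) := by
  have h := (integrable_rpow_neg_one_add_norm_sq (E := E d) (μ := volume) (r := 2 * b)
    (by simp only [finrank_euclideanSpace, Fintype.card_fin]; linarith)).comp_smul
    (R := 2 * Real.pi) (by simp [Real.pi_ne_zero])
  refine h.congr (.of_forall fun ξ ↦ ?_)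
  simp only [bracketSq]
  congr 1
  ring

/-- The weights `m` that dominate `(1 + |2πξ|²)^{b/2}` up to an integrable singularity: for
`b > d/2` the space `L²(m² dξ)` is then contained in `L¹` and acts on `L²(besselWeight b)` by
convolution. -/
structure AdmissibleWeight (b : ℝ) (m : E d → ℝ) : Prop where
  measurable : Measurable m
  bound : ∃ h : E d → ℝ, Integrable h ∧ (∀ ξ, 0 ≤ h ξ) ∧
    ∀ᵐ ξ, 0 < m ξ ∧ (m ξ ^ 2)⁻¹ ≤ bracketSq ξ ^ (-b) * (2 + h ξ)

theorem AdmissibleWeight.ae_pos {b : ℝ} {m : E d → ℝ} (hm : AdmissibleWeight b m) :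
    ∀ᵐ ξ, 0 < m ξ := by
  obtain ⟨_, _, _, hbound⟩ := hm.bound
  exact hbound.mono fun _ h ↦ h.1

theorem admissibleWeight_besselWeight (b : ℝ) :
    AdmissibleWeight b (besselWeight b : E d → ℝ) := by
  refine ⟨by fun_prop, 0, integrable_zero _ _ _, fun _ ↦ le_rfl, .of_forall fun ξ ↦
    ⟨besselWeight_pos b ξ, ?_⟩⟩
  rw [besselWeight_sq, Real.rpow_neg (bracketSq_pos ξ).le]
  have := inv_nonneg.2 (Real.rpow_nonneg (bracketSq_pos ξ).le b)
  simp only [Pi.zero_apply]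
  linarith

/-- The weight `|2πξ| (1 + |2πξ|²)^{b/2}`; the corresponding weighted norm of `𝓕 u` is
`‖∇u‖_{H^b}`. -/
def gradWeight (b : ℝ) (ξ : E d) : ℝ := ‖(2 * Real.pi) • ξ‖ * besselWeight b ξ

@[fun_prop]
theorem measurable_gradWeight (b : ℝ) : Measurable (gradWeight b : E d → ℝ) := by
  unfold gradWeight; fun_prop

theorem gradWeight_nonneg (b : ℝ) (ξ : E d) : 0 ≤ gradWeight b ξ :=
  mul_nonneg (norm_nonneg _) (besselWeight_pos b ξ).le

theorem gradWeight_mono {a b : ℝ} (hab : a ≤ b) (ξ : E d) : gradWeight a ξ ≤ gradWeight b ξ :=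
  mul_le_mul_of_nonneg_left (besselWeight_mono hab ξ) (norm_nonneg _)

theorem gradWeight_le_besselWeight (b : ℝ) (ξ : E d) :
    gradWeight b ξ ≤ besselWeight (b + 1) ξ := by
  rw [add_comm, besselWeight_add, besselWeight_one]
  refine mul_le_mul_of_nonneg_right (Real.le_sqrt_of_sq_le ?_) (besselWeight_pos b ξ).le
  exact le_add_of_nonneg_left zero_le_one

theorem besselWeight_le_gradWeight_add (b : ℝ) (ξ : E d) :
    besselWeight (b + 1) ξ ≤ gradWeight b ξ + besselWeight b ξ := by
  have hroot : √(bracketSq ξ) ≤ ‖(2 * Real.pi) • ξ‖ + 1 := by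
    refine Real.sqrt_le_iff.2 ⟨by positivity, ?_⟩
    unfold bracketSq
    nlinarith [norm_nonneg ((2 * Real.pi) • ξ)]
  rw [add_comm b, besselWeight_add, besselWeight_one, gradWeight]
  nlinarith [besselWeight_pos b ξ]

theorem integrable_indicator_inv_norm_sq (hd : 3 ≤ d) :
    Integrable ((Metric.ball (0 : E d) 1).indicator fun ξ ↦ (‖ξ‖ ^ 2)⁻¹) := by
  rw [integrable_indicator_iff Metric.isOpen_ball.measurableSet]
  have hd' : (3 : ℝ) ≤ d := by exact_mod_cast hd
  refine integrableOn_ball_of_norm_le_rpow (C := 1) (α := 2)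
    (by simp only [finrank_euclideanSpace, Fintype.card_fin]; omega)
    (by simp only [finrank_euclideanSpace, Fintype.card_fin]; linarith)
    (.of_forall fun ξ ↦ ?_) (Measurable.aestronglyMeasurable (by fun_prop))
  rw [Real.rpow_neg (norm_nonneg _), Real.rpow_two, one_mul, norm_inv, norm_pow, norm_norm]

theorem inv_norm_sq_mul_one_add_le {V : Type*} [NormedAddCommGroup V] {η : V} (hη : η ≠ 0) :
    (‖η‖ ^ 2)⁻¹ * (1 + ‖η‖ ^ 2) ≤
      2 + (Metric.ball (0 : V) 1).indicator (fun η ↦ (‖η‖ ^ 2)⁻¹) η := by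
  rw [mul_add, inv_mul_cancel₀ (pow_ne_zero 2 (norm_ne_zero_iff.2 hη)), mul_one]
  by_cases hball : η ∈ Metric.ball (0 : V) 1
  · rw [Set.indicator_of_mem hball]
    linarith
  · rw [Set.indicator_of_notMem hball]
    have hone : 1 ≤ ‖η‖ := by simpa using hball
    linarith [inv_le_one_of_one_le₀ (one_le_pow₀ hone : 1 ≤ ‖η‖ ^ 2)]

-- The singularity `|ξ|⁻²` of the squared inverse weight is integrable exactly when `d ≥ 3`.
theorem admissibleWeight_gradWeight (hd : 3 ≤ d) (b : ℝ) :
    AdmissibleWeight b (gradWeight (b - 1) : E d → ℝ) := by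
  refine ⟨by fun_prop, fun ξ ↦ (Metric.ball (0 : E d) 1).indicator (fun ξ ↦ (‖ξ‖ ^ 2)⁻¹)
    ((2 * Real.pi) • ξ), ?_, fun ξ ↦ Set.indicator_nonneg (fun _ _ ↦ by positivity) _, ?_⟩
  · exact (integrable_indicator_inv_norm_sq hd).comp_smul (by simp [Real.pi_ne_zero])
  have : Nontrivial (E d) :=
    Module.nontrivial_of_finrank_pos (R := ℝ) (by rw [finrank_euclideanSpace_fin]; omega)
  filter_upwards [Measure.ae_ne volume (0 : E d)] with ξ hξ
  have hη : (2 * Real.pi) • ξ ≠ 0 := by simp [Real.pi_ne_zero, hξ]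
  refine ⟨mul_pos (norm_pos_iff.2 hη) (besselWeight_pos _ _), ?_⟩
  calc (gradWeight (b - 1) ξ ^ 2)⁻¹
      = bracketSq ξ ^ (-b) * ((‖(2 * Real.pi) • ξ‖ ^ 2)⁻¹ * bracketSq ξ) := by
        rw [gradWeight, mul_pow, besselWeight_sq, mul_inv, ← Real.rpow_neg (bracketSq_pos ξ).le,
          show -(b - 1) = -b + 1 by ring, Real.rpow_add_one (bracketSq_pos ξ).ne']
        ring
    _ ≤ _ := mul_le_mul_of_nonneg_left (inv_norm_sq_mul_one_add_le hη)
        (Real.rpow_nonneg (bracketSq_pos ξ).le _)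

theorem rpow_mul_rpow_neg_mul_rpow_neg_le {x y z a b : ℝ} (hx : 0 < x) (hy : 0 < y) (hz : 0 ≤ z)
    (hzm : z ≤ 4 * max x y) (ha : 0 ≤ a) (hab : a ≤ b) :
    z ^ a * x ^ (-a) * y ^ (-b) ≤ 4 ^ a * (y ^ (-b) + x ^ (-b)) := by
  have hyb : 0 < y ^ (-b) := by positivity
  have hxb : 0 < x ^ (-b) := by positivity
  rcases le_total y x with hyx | hxy
  · rw [max_eq_left hyx] at hzm
    calc z ^ a * x ^ (-a) * y ^ (-b) ≤ (4 * x) ^ a * x ^ (-a) * y ^ (-b) := by gcongr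
      _ = 4 ^ a * (x ^ a * x ^ (-a)) * y ^ (-b) := by
        rw [Real.mul_rpow (by norm_num) hx.le]; ring
      _ = 4 ^ a * y ^ (-b) := by rw [← Real.rpow_add hx, add_neg_cancel, Real.rpow_zero, mul_one]
      _ ≤ _ := by gcongr; linarith
  · rw [max_eq_right hxy] at hzm
    calc z ^ a * x ^ (-a) * y ^ (-b) ≤ (4 * y) ^ a * x ^ (-a) * y ^ (-b) := by gcongr
      _ = 4 ^ a * (x ^ (-a) * y ^ (a - b)) := by
        rw [Real.mul_rpow (by norm_num) hy.le, sub_eq_add_neg a b, Real.rpow_add hy]; ring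
      _ ≤ 4 ^ a * (x ^ (-a) * x ^ (a - b)) := by
        have := Real.rpow_le_rpow_of_nonpos hx hxy (by linarith : a - b ≤ 0)
        gcongr
      _ = 4 ^ a * x ^ (-b) := by rw [← Real.rpow_add hx]; ring_nf
      _ ≤ _ := by gcongr; linarith

/-- The kernel of convolution between weighted `L²` spaces: for `F = f / besselWeight a` and
`G = g / m`, the function `besselWeight a • (F ⋆ G)` at `ξ` is the integral of
`f t * g (ξ - t)` against it. -/
def convKernel (a : ℝ) (m : E d → ℝ) (ξ t : E d) : ℝ :=
  besselWeight a ξ * (besselWeight a t)⁻¹ * (m (ξ - t))⁻¹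

variable {a b : ℝ} {m : E d → ℝ}

theorem ae_comp_sub_left {p : E d → Prop} (h : ∀ᵐ ξ, p ξ) (ξ : E d) : ∀ᵐ t, p (ξ - t) :=
  (Measure.measurePreserving_sub_left volume ξ).quasiMeasurePreserving.ae h

theorem convKernel_sq (ξ t : E d) : convKernel a m ξ t ^ 2 =
    bracketSq ξ ^ a * bracketSq t ^ (-a) * (m (ξ - t) ^ 2)⁻¹ := by
  rw [convKernel, mul_pow, mul_pow, inv_pow, inv_pow, besselWeight_sq, besselWeight_sq,
    Real.rpow_neg (bracketSq_pos t).le]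

theorem AdmissibleWeight.exists_convKernel_sq_le (hm : AdmissibleWeight b m) (ha : 0 ≤ a)
    (hab : a ≤ b) (hb : (d : ℝ) / 2 < b) :
    ∃ p q : E d → ℝ, Integrable p ∧ Integrable q ∧
      ∀ ξ, ∀ᵐ t, convKernel a m ξ t ^ 2 ≤ p t + q (ξ - t) := by
  obtain ⟨h, hint, hnonneg, hbound⟩ := hm.bound
  have hJ := integrable_bracketSq_rpow (d := d) hb
  refine ⟨fun t ↦ 4 ^ a * (2 * bracketSq t ^ (-b)),
    fun t ↦ 4 ^ a * (2 * bracketSq t ^ (-b) + 2 * h t), (hJ.const_mul _).const_mul _,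
    ((hJ.const_mul _).add (hint.const_mul _)).const_mul _, fun ξ ↦ ?_⟩
  filter_upwards [ae_comp_sub_left hbound ξ] with t ht
  have hh := hnonneg (ξ - t)
  have hbase := rpow_mul_rpow_neg_mul_rpow_neg_le (bracketSq_pos t) (bracketSq_pos (ξ - t))
    (bracketSq_pos ξ).le (bracketSq_le_four_mul_max ξ t) ha hab
  have hle_one : ∀ η : E d, bracketSq η ^ (-b) ≤ 1 := fun η ↦
    Real.rpow_le_one_of_one_le_of_nonpos (one_le_bracketSq η) (by linarith)
  have hprefactor : 0 ≤ bracketSq ξ ^ a * bracketSq t ^ (-a) :=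
    mul_nonneg (Real.rpow_nonneg (bracketSq_pos _).le _) (Real.rpow_nonneg (bracketSq_pos _).le _)
  calc convKernel a m ξ t ^ 2
      ≤ bracketSq ξ ^ a * bracketSq t ^ (-a) *
          (bracketSq (ξ - t) ^ (-b) * (2 + h (ξ - t))) := by
        rw [convKernel_sq]
        exact mul_le_mul_of_nonneg_left ht.2 hprefactor
    _ = bracketSq ξ ^ a * bracketSq t ^ (-a) * bracketSq (ξ - t) ^ (-b) *
          (2 + h (ξ - t)) := by ring
    _ ≤ 4 ^ a * (bracketSq (ξ - t) ^ (-b) + bracketSq t ^ (-b)) * (2 + h (ξ - t)) := by gcongr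
    _ = 4 ^ a * ((bracketSq (ξ - t) ^ (-b) + bracketSq t ^ (-b)) * 2 +
          (bracketSq (ξ - t) ^ (-b) + bracketSq t ^ (-b)) * h (ξ - t)) := by ring
    _ ≤ 4 ^ a * ((bracketSq (ξ - t) ^ (-b) + bracketSq t ^ (-b)) * 2 +
          (1 + 1) * h (ξ - t)) := by
        gcongr <;> exact hle_one _
    _ = _ := by ring

theorem AdmissibleWeight.exists_lintegral_convKernel_sq_le (hm : AdmissibleWeight b m)
    (ha : 0 ≤ a) (hab : a ≤ b) (hb : (d : ℝ) / 2 < b) :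
    ∃ K : ℝ≥0, ∀ ξ, ∫⁻ t, ENNReal.ofReal (convKernel a m ξ t ^ 2) ≤ (K : ℝ≥0∞) ^ 2 := by
  obtain ⟨p, q, hp, hq, hpq⟩ := hm.exists_convKernel_sq_le ha hab hb
  set k := (∫⁻ t, ENNReal.ofReal (p t)) + ∫⁻ t, ENNReal.ofReal (q t)
  have hk : k ≠ ∞ := ENNReal.add_ne_top.2 ⟨hp.lintegral_lt_top.ne, hq.lintegral_lt_top.ne⟩
  refine ⟨NNReal.sqrt k.toNNReal, fun ξ ↦ ?_⟩
  calc ∫⁻ t, ENNReal.ofReal (convKernel a m ξ t ^ 2)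
      ≤ ∫⁻ t, (ENNReal.ofReal (p t) + ENNReal.ofReal (q (ξ - t))) := by
        refine lintegral_mono_ae ?_
        filter_upwards [hpq ξ] with t ht
        exact (ENNReal.ofReal_le_ofReal ht).trans ENNReal.ofReal_add_le
    _ = k := by
        rw [lintegral_add_left' hp.1.aemeasurable.ennreal_ofReal,
          lintegral_sub_left_eq_self (fun t ↦ ENNReal.ofReal (q t)) ξ]
    _ = _ := by rw [← ENNReal.coe_pow, NNReal.sq_sqrt, ENNReal.coe_toNNReal hk]

theorem sq_lintegral_mul_le {α : Type*} [MeasurableSpace α] {μ : Measure α} {u v : α → ℝ≥0∞}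
    (hu : AEMeasurable u μ) (hv : AEMeasurable v μ) :
    (∫⁻ x, u x * v x ∂μ) ^ 2 ≤ (∫⁻ x, u x ^ 2 ∂μ) * ∫⁻ x, v x ^ 2 ∂μ := by
  have h := ENNReal.lintegral_mul_le_Lp_mul_Lq μ .two_two hu hv
  simp only [Pi.mul_apply, ENNReal.rpow_two] at h
  calc (∫⁻ x, u x * v x ∂μ) ^ 2
      ≤ ((∫⁻ x, u x ^ 2 ∂μ) ^ (1 / 2 : ℝ) * (∫⁻ x, v x ^ 2 ∂μ) ^ (1 / 2 : ℝ)) ^ 2 := by gcongr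
    _ = _ := by
      rw [mul_pow, ← ENNReal.rpow_mul_natCast, ← ENNReal.rpow_mul_natCast]
      norm_num

theorem lintegral_lintegral_mul_sub {G : Type*} [AddCommGroup G] [MeasurableSpace G]
    [MeasurableAdd₂ G] [MeasurableNeg G] {μ : Measure G} [SFinite μ] [μ.IsAddRightInvariant]
    {f g : G → ℝ≥0∞} (hf : AEMeasurable f μ) (hg : AEMeasurable g μ) :
    ∫⁻ x, ∫⁻ t, f t * g (x - t) ∂μ ∂μ = (∫⁻ t, f t ∂μ) * ∫⁻ x, g x ∂μ := by
  have hg' : AEMeasurable (fun p : G × G ↦ g (p.1 - p.2)) (μ.prod μ) :=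
    hg.comp_quasiMeasurePreserving (quasiMeasurePreserving_sub_of_right_invariant μ μ)
  have hshift : ∀ t, AEMeasurable (fun x ↦ g (x - t)) μ := fun t ↦
    hg.comp_quasiMeasurePreserving (measurePreserving_sub_right μ t).quasiMeasurePreserving
  rw [lintegral_lintegral_swap (hf.comp_snd.mul hg'), ← lintegral_mul_const'' _ hf]
  refine lintegral_congr fun t ↦ ?_
  rw [lintegral_const_mul'' _ (hshift t), lintegral_sub_right_eq_self g t]

theorem weightedNorm_sq (m : E d → ℝ) (F : E d → ℂ) :
    weightedNorm m F ^ 2 = ∫⁻ ξ, ‖(m ξ : ℂ) * F ξ‖ₑ ^ 2 := by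
  have := eLpNorm_nnreal_pow_eq_lintegral (f := fun ξ ↦ (m ξ : ℂ) * F ξ)
    (μ := (volume : Measure (E d))) (p := 2) (by norm_num)
  simpa [weightedNorm] using this

theorem aemeasurable_enorm_mul (hm : Measurable m) {F : E d → ℂ}
    (hF : AEStronglyMeasurable F volume) : AEMeasurable fun ξ ↦ ‖(m ξ : ℂ) * F ξ‖ₑ :=
  ((Measurable.aestronglyMeasurable (by fun_prop)).mul hF).enorm

theorem norm_besselWeight_mul (σ : ℝ) (ξ : E d) (z : ℂ) :
    ‖(besselWeight σ ξ : ℂ) * z‖ = besselWeight σ ξ * ‖z‖ := by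
  rw [norm_mul, Complex.norm_real, Real.norm_of_nonneg (besselWeight_pos _ _).le]

theorem norm_gradWeight_mul (b : ℝ) (ξ : E d) (z : ℂ) :
    ‖(gradWeight b ξ : ℂ) * z‖ = gradWeight b ξ * ‖z‖ := by
  rw [norm_mul, Complex.norm_real, Real.norm_of_nonneg (gradWeight_nonneg _ _)]

theorem enorm_besselWeight_mul_convolution_le (hm : ∀ᵐ ξ, 0 < m ξ) (F G : E d → ℂ) (ξ : E d) :
    ‖(besselWeight a ξ : ℂ) * (F ⋆ₘ G) ξ‖ₑ ≤
      ∫⁻ t, (‖(besselWeight a t : ℂ) * F t‖ₑ * ‖(m (ξ - t) : ℂ) * G (ξ - t)‖ₑ) *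
        ENNReal.ofReal (convKernel a m ξ t) := by
  rw [convolution_def, ← integral_const_mul]
  refine (enorm_integral_le_lintegral_enorm _).trans (lintegral_mono_ae ?_)
  filter_upwards [ae_comp_sub_left hm ξ] with t ht
  have hξ := besselWeight_pos a ξ
  have htpos := besselWeight_pos a t
  simp only [← ofReal_norm]
  rw [← ENNReal.ofReal_mul (norm_nonneg _), ← ENNReal.ofReal_mul (by positivity)]
  refine ENNReal.ofReal_le_ofReal (le_of_eq ?_)
  simp only [norm_mul, Complex.norm_real, Real.norm_of_nonneg ht.le, Real.norm_of_nonneg hξ.le,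
    Real.norm_of_nonneg htpos.le, ContinuousLinearMap.mul_apply', convKernel]
  field_simp

theorem AdmissibleWeight.exists_weightedNorm_convolution_le (hm : AdmissibleWeight b m)
    (ha : 0 ≤ a) (hab : a ≤ b) (hb : (d : ℝ) / 2 < b) :
    ∃ K : ℝ≥0, ∀ F G : E d → ℂ, AEStronglyMeasurable F volume → AEStronglyMeasurable G volume →
      weightedNorm (besselWeight a) (F ⋆ₘ G) ≤
        K * weightedNorm (besselWeight a) F * weightedNorm m G := by
  obtain ⟨K, hK⟩ := hm.exists_lintegral_convKernel_sq_le ha hab hb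
  have hmm := hm.measurable
  refine ⟨K, fun F G hF hG ↦ ?_⟩
  rw [← ENNReal.pow_le_pow_left_iff two_ne_zero, mul_pow, mul_pow, weightedNorm_sq,
    weightedNorm_sq, weightedNorm_sq]
  set f : E d → ℝ≥0∞ := fun t ↦ ‖(besselWeight a t : ℂ) * F t‖ₑ
  set g : E d → ℝ≥0∞ := fun t ↦ ‖(m t : ℂ) * G t‖ₑ
  have hf : AEMeasurable f volume := aemeasurable_enorm_mul (by fun_prop) hF
  have hg : AEMeasurable g volume := aemeasurable_enorm_mul hmm hG
  have hkernel : ∀ ξ, Measurable fun t ↦ ENNReal.ofReal (convKernel a m ξ t) := fun ξ ↦ by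
    unfold convKernel; fun_prop
  have hkernel_sq : ∀ ξ, ∫⁻ t, ENNReal.ofReal (convKernel a m ξ t) ^ 2 ≤ (K : ℝ≥0∞) ^ 2 := by
    refine fun ξ ↦ (hK ξ).trans' (lintegral_mono_ae ?_)
    filter_upwards [ae_comp_sub_left hm.ae_pos ξ] with t ht
    rw [ENNReal.ofReal_pow]
    exact mul_nonneg (mul_nonneg (besselWeight_pos _ _).le (inv_nonneg.2 (besselWeight_pos _ _).le))
      (inv_nonneg.2 ht.le)
  have hpointwise : ∀ ξ, ‖(besselWeight a ξ : ℂ) * (F ⋆ₘ G) ξ‖ₑ ^ 2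
      ≤ (K : ℝ≥0∞) ^ 2 * ∫⁻ t, f t ^ 2 * g (ξ - t) ^ 2 := fun ξ ↦ by
    have hgξ : AEMeasurable fun t ↦ g (ξ - t) := hg.comp_quasiMeasurePreserving
      (Measure.measurePreserving_sub_left volume ξ).quasiMeasurePreserving
    calc _ ≤ (∫⁻ t, (f t * g (ξ - t)) * ENNReal.ofReal (convKernel a m ξ t)) ^ 2 :=
          pow_le_pow_left' (enorm_besselWeight_mul_convolution_le hm.ae_pos F G ξ) 2
      _ ≤ (∫⁻ t, (f t * g (ξ - t)) ^ 2) * ∫⁻ t, ENNReal.ofReal (convKernel a m ξ t) ^ 2 :=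
          sq_lintegral_mul_le (hf.mul hgξ) (hkernel ξ).aemeasurable
      _ ≤ (∫⁻ t, (f t * g (ξ - t)) ^ 2) * (K : ℝ≥0∞) ^ 2 := by gcongr; exact hkernel_sq ξ
      _ = _ := by rw [mul_comm]; simp only [mul_pow]
  refine (lintegral_mono hpointwise).trans_eq ?_
  rw [lintegral_const_mul' _ _ (by finiteness),
    lintegral_lintegral_mul_sub (hf.pow_const 2) (hg.pow_const 2), mul_assoc]

theorem AdmissibleWeight.exists_lintegral_enorm_le (hm : AdmissibleWeight b m)
    (hb : (d : ℝ) / 2 < b) :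
    ∃ K : ℝ≥0, ∀ G : E d → ℂ, AEStronglyMeasurable G volume →
      ∫⁻ ξ, ‖G ξ‖ₑ ≤ K * weightedNorm m G := by
  have hb0 : 0 ≤ b := le_trans (by positivity) hb.le
  obtain ⟨K, hK⟩ := hm.exists_lintegral_convKernel_sq_le le_rfl hb0 hb
  have hmm := hm.measurable
  refine ⟨K, fun G hG ↦ ?_⟩
  rw [← ENNReal.pow_le_pow_left_iff two_ne_zero, mul_pow, weightedNorm_sq]
  have hinv : ∫⁻ t, ENNReal.ofReal (m t)⁻¹ ^ 2 ≤ (K : ℝ≥0∞) ^ 2 := by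
    refine (hK 0).trans' ?_
    rw [← lintegral_sub_left_eq_self _ (0 : E d)]
    refine lintegral_mono_ae ?_
    filter_upwards [ae_comp_sub_left hm.ae_pos 0] with t ht
    rw [convKernel, besselWeight_zero, besselWeight_zero, inv_one, one_mul, one_mul,
      ENNReal.ofReal_pow (inv_nonneg.2 ht.le)]
  calc (∫⁻ ξ, ‖G ξ‖ₑ) ^ 2 = (∫⁻ ξ, ‖(m ξ : ℂ) * G ξ‖ₑ * ENNReal.ofReal (m ξ)⁻¹) ^ 2 := by
        congr 1
        refine lintegral_congr_ae ?_
        filter_upwards [hm.ae_pos] with ξ hpos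
        rw [← ofReal_norm, ← ofReal_norm, ← ENNReal.ofReal_mul (norm_nonneg _), norm_mul,
          Complex.norm_real, Real.norm_of_nonneg hpos.le]
        field_simp
    _ ≤ (∫⁻ ξ, ‖(m ξ : ℂ) * G ξ‖ₑ ^ 2) * ∫⁻ ξ, ENNReal.ofReal (m ξ)⁻¹ ^ 2 :=
        sq_lintegral_mul_le (aemeasurable_enorm_mul hmm hG)
          (Measurable.aemeasurable (by fun_prop))
    _ ≤ (∫⁻ ξ, ‖(m ξ : ℂ) * G ξ‖ₑ ^ 2) * (K : ℝ≥0∞) ^ 2 := by gcongr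
    _ = _ := mul_comm _ _

open scoped Topology
open Filter

/-- The `L²` norm of `F` with weight `m` is at most `C`; this includes the measurability of `F`. -/
def WeightedBound (m : E d → ℝ) (F : E d → ℂ) (C : ℝ≥0) : Prop :=
  AEStronglyMeasurable F volume ∧ weightedNorm m F ≤ C

namespace WeightedBound

variable {m : E d → ℝ} {F G : E d → ℂ} {A B : ℝ≥0}

theorem mono (h : WeightedBound m F A) (hAB : A ≤ B) : WeightedBound m F B :=
  ⟨h.1, h.2.trans (by exact_mod_cast hAB)⟩

theorem congr (h : WeightedBound m F A) (hFG : F =ᵐ[volume] G) : WeightedBound m G A := by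
  refine ⟨h.1.congr hFG, h.2.trans' (eLpNorm_congr_ae ?_).le⟩
  filter_upwards [hFG] with ξ hξ
  rw [hξ]

theorem of_sum_le {ι : Type*} (s : Finset ι) {m' : ι → E d → ℝ} {F' : ι → E d → ℂ} {C : ι → ℝ≥0}
    (hF : AEStronglyMeasurable F volume) (hm : ∀ i ∈ s, Measurable (m' i))
    (h : ∀ i ∈ s, WeightedBound (m' i) (F' i) (C i))
    (hle : ∀ᵐ ξ, ‖(m ξ : ℂ) * F ξ‖ ≤ ∑ i ∈ s, ‖(m' i ξ : ℂ) * F' i ξ‖) :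
    WeightedBound m F (∑ i ∈ s, C i) := by
  refine ⟨hF, ?_⟩
  have hmeas : ∀ i ∈ s, AEStronglyMeasurable (fun ξ ↦ ‖(m' i ξ : ℂ) * F' i ξ‖) volume := by
    intro i hi
    have := hm i hi
    exact ((Measurable.aestronglyMeasurable (by fun_prop)).mul (h i hi).1).norm
  calc weightedNorm m F ≤ eLpNorm (∑ i ∈ s, fun ξ ↦ ‖(m' i ξ : ℂ) * F' i ξ‖) 2 volume := by
        refine eLpNorm_mono_ae_real ?_
        filter_upwards [hle] with ξ hξ
        simpa only [Finset.sum_apply] using hξ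
    _ ≤ ∑ i ∈ s, eLpNorm (fun ξ ↦ ‖(m' i ξ : ℂ) * F' i ξ‖) 2 volume :=
        eLpNorm_sum_le hmeas (by norm_num)
    _ ≤ ∑ i ∈ s, (C i : ℝ≥0∞) := by
        refine Finset.sum_le_sum fun i hi ↦ ?_
        rw [eLpNorm_norm]
        exact (h i hi).2
    _ = _ := (ENNReal.ofNNReal_finsetSum ..).symm

theorem of_le {m' : E d → ℝ} (h : WeightedBound m' G A) (hF : AEStronglyMeasurable F volume)
    (hle : ∀ᵐ ξ, ‖(m ξ : ℂ) * F ξ‖ ≤ ‖(m' ξ : ℂ) * G ξ‖) : WeightedBound m F A :=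
  ⟨hF, (eLpNorm_mono_ae hle).trans h.2⟩

theorem of_le_add {m₁ m₂ : E d → ℝ} {F₁ F₂ : E d → ℂ} (h₁ : WeightedBound m₁ F₁ A)
    (h₂ : WeightedBound m₂ F₂ B) (hF : AEStronglyMeasurable F volume) (hm₁ : Measurable m₁)
    (hm₂ : Measurable m₂)
    (hle : ∀ᵐ ξ, ‖(m ξ : ℂ) * F ξ‖ ≤ ‖(m₁ ξ : ℂ) * F₁ ξ‖ + ‖(m₂ ξ : ℂ) * F₂ ξ‖) :
    WeightedBound m F (A + B) := by
  simpa using of_sum_le (m := m) (F := F) (Finset.univ : Finset Bool)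
    (m' := fun b ↦ bif b then m₁ else m₂)
    (F' := fun b ↦ bif b then F₁ else F₂) (C := fun b ↦ bif b then A else B) hF
    (by rintro (_ | _) - <;> assumption) (by rintro (_ | _) - <;> assumption)
    (by simpa using hle)

theorem add (h : WeightedBound m F A) (h' : WeightedBound m G B) (hm : Measurable m) :
    WeightedBound m (F + G) (A + B) :=
  of_le_add h h' (h.1.add h'.1) hm hm (.of_forall fun ξ ↦ by
    rw [Pi.add_apply, mul_add]; exact norm_add_le _ _)

theorem sum {ι : Type*} (s : Finset ι) {F : ι → E d → ℂ} {C : ι → ℝ≥0}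
    (h : ∀ i ∈ s, WeightedBound m (F i) (C i)) (hm : Measurable m) :
    WeightedBound m (∑ i ∈ s, F i) (∑ i ∈ s, C i) := by
  refine of_sum_le s (Finset.aestronglyMeasurable_sum _ fun i hi ↦ (h i hi).1)
    (fun _ _ ↦ hm) h (.of_forall fun ξ ↦ ?_)
  rw [Finset.sum_apply, Finset.mul_sum]
  exact norm_sum_le _ _

theorem smul (h : WeightedBound m F A) (c : ℂ) : WeightedBound m (c • F) (‖c‖₊ * A) := by
  refine ⟨h.1.const_smul c, ?_⟩
  have hcomm : (fun ξ ↦ (m ξ : ℂ) * (c • F) ξ) = c • fun ξ ↦ (m ξ : ℂ) * F ξ := by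
    ext ξ
    simp only [Pi.smul_apply, smul_eq_mul]
    ring
  rw [weightedNorm, hcomm, eLpNorm_const_smul, ENNReal.coe_mul]
  exact mul_le_mul' le_rfl h.2

theorem neg (h : WeightedBound m F A) : WeightedBound m (-F) A := by
  simpa using h.smul (-1)

theorem sub (h : WeightedBound m F A) (h' : WeightedBound m G B) (hm : Measurable m) :
    WeightedBound m (F - G) (A + B) := by
  rw [sub_eq_add_neg]
  exact h.add h'.neg hm

theorem ofReal_norm (h : WeightedBound m F A) : WeightedBound m (fun ξ ↦ (‖F ξ‖ : ℂ)) A :=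
  h.of_le (Complex.continuous_ofReal.comp_aestronglyMeasurable h.1.norm)
    (.of_forall fun ξ ↦ by simp)

theorem besselWeight_mul {a b : ℝ} (h : WeightedBound (besselWeight (a + b)) F A) :
    WeightedBound (besselWeight a) (fun ξ ↦ (besselWeight b ξ : ℂ) * F ξ) A := by
  refine h.of_le ((Measurable.aestronglyMeasurable (by fun_prop)).mul h.1)
    (.of_forall fun ξ ↦ le_of_eq ?_)
  rw [besselWeight_add, Complex.ofReal_mul, mul_assoc]

theorem anti {a b : ℝ} (h : WeightedBound (besselWeight b) F A) (hab : a ≤ b) :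
    WeightedBound (besselWeight a) F A := by
  refine h.of_le h.1 (.of_forall fun ξ ↦ ?_)
  simp only [norm_besselWeight_mul]
  gcongr
  exact besselWeight_mono hab ξ

theorem memLp_mul (h : WeightedBound m F A) (hm : Measurable m) :
    MemLp (fun ξ ↦ (m ξ : ℂ) * F ξ) 2 volume :=
  ⟨(Measurable.aestronglyMeasurable (by fun_prop)).mul h.1, h.2.trans_lt ENNReal.coe_lt_top⟩

theorem memLp {a : ℝ} (h : WeightedBound (besselWeight a) F A) (ha : 0 ≤ a) :
    MemLp F 2 volume := by
  simpa [besselWeight_zero] using (h.anti ha).memLp_mul (by fun_prop)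

theorem of_tendsto {S : ℕ → E d → ℂ} (h : ∀ n, WeightedBound m (S n) A)
    (hF : AEStronglyMeasurable F volume) (hm : Measurable m)
    (hlim : Tendsto (fun n ↦ eLpNorm (S n - F) 2 volume) atTop (𝓝 0)) : WeightedBound m F A := by
  obtain ⟨ns, -, hns⟩ := (tendstoInMeasure_of_tendsto_eLpNorm (by norm_num) (fun n ↦ (h n).1) hF
    hlim).exists_seq_tendsto_ae
  have hfatou := Lp.eLpNorm_lim_le_liminf_eLpNorm (p := 2) (μ := (volume : Measure (E d)))
    (f := fun n ξ ↦ (m ξ : ℂ) * S (ns n) ξ)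
    (fun n ↦ (Measurable.aestronglyMeasurable (by fun_prop)).mul (h (ns n)).1)
    (fun ξ ↦ (m ξ : ℂ) * F ξ) (by
      filter_upwards [hns] with ξ hξ
      exact hξ.const_mul _)
  refine ⟨hF, hfatou.trans ?_⟩
  exact (Filter.liminf_le_liminf (.of_forall fun n ↦ (h (ns n)).2)).trans (by simp)

end WeightedBound

theorem weightedBound_of_memLp {m : E d → ℝ} {F : E d → ℂ} (hF : AEStronglyMeasurable F volume)
    (h : MemLp (fun ξ ↦ (m ξ : ℂ) * F ξ) 2 volume) :
    WeightedBound m F (weightedNorm m F).toNNReal :=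
  ⟨hF, (ENNReal.coe_toNNReal h.2.ne).ge⟩

theorem aestronglyMeasurable_convolution {F G : E d → ℂ} (hF : AEStronglyMeasurable F volume)
    (hG : AEStronglyMeasurable G volume) : AEStronglyMeasurable (F ⋆ₘ G) volume :=
  (hF.convolution_integrand (ContinuousLinearMap.mul ℂ ℂ) hG).integral_prod_right'

theorem AdmissibleWeight.exists_weightedBound_convolution {a b : ℝ} {m : E d → ℝ}
    (hm : AdmissibleWeight b m) (ha : 0 ≤ a) (hab : a ≤ b) (hb : (d : ℝ) / 2 < b) :
    ∃ K : ℝ≥0, ∀ (F G : E d → ℂ) (A B : ℝ≥0), WeightedBound (besselWeight a) F A →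
      WeightedBound m G B → WeightedBound (besselWeight a) (F ⋆ₘ G) (K * A * B) := by
  obtain ⟨K, hK⟩ := hm.exists_weightedNorm_convolution_le ha hab hb
  refine ⟨K, fun F G A B hF hG ↦ ⟨aestronglyMeasurable_convolution hF.1 hG.1,
    (hK F G hF.1 hG.1).trans ?_⟩⟩
  push_cast
  gcongr
  exacts [hF.2, hG.2]

theorem AdmissibleWeight.exists_integral_norm_le {b : ℝ} {m : E d → ℝ} (hm : AdmissibleWeight b m)
    (hb : (d : ℝ) / 2 < b) :
    ∃ K : ℝ≥0, ∀ (G : E d → ℂ) (B : ℝ≥0), WeightedBound m G B →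
      Integrable G ∧ ∫ ξ, ‖G ξ‖ ≤ K * B := by
  obtain ⟨K, hK⟩ := hm.exists_lintegral_enorm_le hb
  refine ⟨K, fun G B hG ↦ ?_⟩
  have hle : ∫⁻ ξ, ‖G ξ‖ₑ ≤ (K * B : ℝ≥0) := by
    refine (hK G hG.1).trans ?_
    push_cast
    gcongr
    exact hG.2
  refine ⟨⟨hG.1, hle.trans_lt ENNReal.coe_lt_top⟩, ?_⟩
  rw [integral_norm_eq_lintegral_enorm hG.1]
  exact ENNReal.toReal_mono ENNReal.coe_ne_top hle

theorem WeightedBound.integrable {b : ℝ} {m : E d → ℝ} {G : E d → ℂ} {B : ℝ≥0}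
    (h : WeightedBound m G B) (hm : AdmissibleWeight b m) (hb : (d : ℝ) / 2 < b) :
    Integrable G := by
  obtain ⟨K, hK⟩ := hm.exists_integral_norm_le hb
  exact (hK G B h).1

theorem derivMul_convolution {F G : E d → ℂ} (i : Fin d) (hF : Integrable F) (hG : Integrable G)
    (hF' : Integrable (derivMul i F)) (hG' : Integrable (derivMul i G)) :
    derivMul i (F ⋆ₘ G) =ᵐ[volume] derivMul i F ⋆ₘ G + F ⋆ₘ derivMul i G := by
  filter_upwards [hF'.ae_convolution_exists (ContinuousLinearMap.mul ℂ ℂ) hG,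
    hF.ae_convolution_exists (ContinuousLinearMap.mul ℂ ℂ) hG'] with ξ hleft hright
  rw [derivMul, Pi.add_apply, convolution_def, convolution_def, convolution_def,
    ← integral_add hleft hright, ← integral_const_mul]
  refine integral_congr_ae (.of_forall fun t ↦ ?_)
  simp only [derivMul, derivSymbol, PiLp.sub_apply, ContinuousLinearMap.mul_apply']
  push_cast
  ring

theorem norm_convolution_ofReal {f g : E d → ℝ} (hf : ∀ t, 0 ≤ f t) (hg : ∀ t, 0 ≤ g t)
    (ξ : E d) :
    ‖((fun t ↦ (f t : ℂ)) ⋆ₘ fun t ↦ (g t : ℂ)) ξ‖ = ∫ t, f t * g (ξ - t) := by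
  have hreal : ((fun t ↦ (f t : ℂ)) ⋆ₘ fun t ↦ (g t : ℂ)) ξ =
      ((∫ t, f t * g (ξ - t) : ℝ) : ℂ) := by
    rw [convolution_def, ← integral_complex_ofReal]
    simp only [ContinuousLinearMap.mul_apply', Complex.ofReal_mul]
  rw [hreal, Complex.norm_real,
    Real.norm_of_nonneg (integral_nonneg fun t ↦ mul_nonneg (hf t) (hg _))]

theorem besselWeight_one_mul_norm_convolution_le {F G : E d → ℂ} (hF : Integrable F)
    (hG : Integrable G) (hF' : Integrable fun ξ ↦ (besselWeight 1 ξ : ℂ) * F ξ)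
    (hG' : Integrable fun ξ ↦ (besselWeight 1 ξ : ℂ) * G ξ) :
    ∀ᵐ ξ, besselWeight 1 ξ * ‖(F ⋆ₘ G) ξ‖ ≤
      2 * (‖((fun t ↦ (‖(besselWeight 1 t : ℂ) * F t‖ : ℂ)) ⋆ₘ fun t ↦ (‖G t‖ : ℂ)) ξ‖ +
        ‖((fun t ↦ (‖F t‖ : ℂ)) ⋆ₘ fun t ↦ (‖(besselWeight 1 t : ℂ) * G t‖ : ℂ)) ξ‖) := by
  filter_upwards [hF'.ae_convolution_exists (ContinuousLinearMap.mul ℂ ℂ) hG,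
    hF.ae_convolution_exists (ContinuousLinearMap.mul ℂ ℂ) hG'] with ξ hleft hright
  have hleft := hleft.norm
  have hright := hright.norm
  simp only [ContinuousLinearMap.mul_apply', norm_mul (_ * _ : ℂ), norm_mul (F _)] at hleft hright
  rw [norm_convolution_ofReal (fun _ ↦ norm_nonneg _) fun _ ↦ norm_nonneg _,
    norm_convolution_ofReal (fun _ ↦ norm_nonneg _) fun _ ↦ norm_nonneg _,
    ← integral_add hleft hright, ← integral_const_mul, ← norm_besselWeight_mul, convolution_def,
    ← integral_const_mul]
  refine norm_integral_le_of_norm_le ((hleft.add hright).const_mul 2) (.of_forall fun t ↦ ?_)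
  simp only [norm_besselWeight_mul, ContinuousLinearMap.mul_apply', norm_mul (F _)]
  calc besselWeight 1 ξ * (‖F t‖ * ‖G (ξ - t)‖)
      ≤ (2 * (besselWeight 1 t + besselWeight 1 (ξ - t))) * (‖F t‖ * ‖G (ξ - t)‖) := by
        gcongr
        exact besselWeight_one_le ξ t
    _ = _ := by ring

theorem exists_tame_convolution {t : ℝ} (ht : (d : ℝ) / 2 < t) :
    ∃ K : ℝ≥0, ∀ (F G : E d → ℂ) (A B A' B' : ℝ≥0), WeightedBound (besselWeight t) F A →
      WeightedBound (besselWeight t) G B → WeightedBound (besselWeight (t + 1)) F A' →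
      WeightedBound (besselWeight (t + 1)) G B' →
      WeightedBound (besselWeight (t + 1)) (F ⋆ₘ G) (K * (A' * B + A * B')) := by
  have hadm := admissibleWeight_besselWeight (d := d) t
  obtain ⟨K, hK⟩ := hadm.exists_weightedBound_convolution (by linarith [d.cast_nonneg (α := ℝ)])
    le_rfl ht
  refine ⟨2 * K, fun F G A B A' B' hF hG hF' hG' ↦ ?_⟩
  have hF1 := hF'.besselWeight_mul
  have hG1 := hG'.besselWeight_mul
  have hsum := WeightedBound.of_le_add (m := besselWeight (t + 1)) (F := F ⋆ₘ G)
    ((hK _ _ _ _ hF1.ofReal_norm hG.ofReal_norm).smul 2)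
    ((hK _ _ _ _ hF.ofReal_norm hG1.ofReal_norm).smul 2)
    (aestronglyMeasurable_convolution hF.1 hG.1) (by fun_prop) (by fun_prop) ?_
  · refine hsum.mono (le_of_eq ?_)
    rw [RCLike.nnnorm_ofNat]
    ring
  filter_upwards [besselWeight_one_mul_norm_convolution_le (hF.integrable hadm ht)
    (hG.integrable hadm ht) (hF1.integrable hadm ht) (hG1.integrable hadm ht)] with ξ hξ
  rw [norm_besselWeight_mul, norm_besselWeight_mul, norm_besselWeight_mul, besselWeight_add,
    mul_assoc, ← mul_add]
  simp only [Pi.smul_apply, norm_smul, Complex.norm_ofNat, ← mul_add]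
  exact mul_le_mul_of_nonneg_left hξ (besselWeight_pos _ ξ).le

theorem tendsto_eLpNorm_zero_of_dominated {α V : Type*} [MeasurableSpace α] {μ : Measure α}
    [NormedAddCommGroup V] {p : ℝ≥0∞} (hp : p ≠ 0) (hp' : p ≠ ∞) {D : ℕ → α → V} {g : α → ℝ}
    (hD : ∀ n, AEStronglyMeasurable (D n) μ) (hg : MemLp g p μ)
    (hbound : ∀ n, ∀ᵐ x ∂μ, ‖D n x‖ ≤ g x)
    (hlim : ∀ᵐ x ∂μ, Tendsto (fun n ↦ D n x) atTop (𝓝 0)) :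
    Tendsto (fun n ↦ eLpNorm (D n) p μ) atTop (𝓝 0) := by
  have hpos : 0 < p.toReal := ENNReal.toReal_pos hp hp'
  have hlintegral : Tendsto (fun n ↦ ∫⁻ x, ‖D n x‖ₑ ^ p.toReal ∂μ) atTop (𝓝 (∫⁻ _, 0 ∂μ)) := by
    refine tendsto_lintegral_of_dominated_convergence' (fun x ↦ ‖g x‖ₑ ^ p.toReal)
      (fun n ↦ (hD n).enorm.pow_const _) (fun n ↦ ?_)
      (lintegral_rpow_enorm_lt_top_of_eLpNorm_lt_top hp hp' hg.2).ne ?_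
    · filter_upwards [hbound n] with x hx
      gcongr
      exact enorm_le_iff_norm_le.2 (hx.trans (Real.le_norm_self _))
    · filter_upwards [hlim] with x hx
      simpa [hpos] using hx.enorm.ennrpow_const p.toReal
  rw [lintegral_zero] at hlintegral
  have hroot := hlintegral.ennrpow_const (1 / p.toReal)
  rw [ENNReal.zero_rpow_of_pos (by positivity)] at hroot
  exact hroot.congr fun n ↦ (eLpNorm_eq_lintegral_rpow_enorm_toReal hp hp').symm

/-- The Fourier transform of `f ^ (n + 1)`, as an iterated convolution of that of `f`. -/
def convPow (F : E d → ℂ) : ℕ → E d → ℂ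
  | 0 => F
  | n + 1 => F ⋆ₘ convPow F n

theorem IsFourierPair.pow_succ {f F : E d → ℂ} (h : IsFourierPair f F)
    (hint : ∀ n, Integrable (convPow F n)) (hpow : ∀ n, MemLp (convPow F n) 2 volume) (n : ℕ) :
    IsFourierPair (fun x ↦ f x ^ (n + 1)) (convPow F n) := by
  induction n with
  | zero => simpa [convPow] using h
  | succ n ih =>
    refine (h.mul ih (hint 0) (hint n) (hpow (n + 1))).congr (.of_forall fun x ↦ ?_) .rfl
    simp only [Pi.mul_apply]
    ring

theorem exists_weightedBound_convPow {t : ℝ} (ht : (d : ℝ) / 2 < t) :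
    ∃ K : ℝ≥0, ∀ (F : E d → ℂ) (A A' : ℝ≥0), WeightedBound (besselWeight t) F A →
      WeightedBound (besselWeight (t + 1)) F A' → ∀ n,
      WeightedBound (besselWeight t) (convPow F n) ((K * A) ^ n * A) ∧
        WeightedBound (besselWeight (t + 1)) (convPow F n) ((n + 1) * (K * A) ^ n * A') := by
  obtain ⟨K₁, hK₁⟩ := (admissibleWeight_besselWeight (d := d) t).exists_weightedBound_convolution
    (by linarith [d.cast_nonneg (α := ℝ)]) le_rfl ht
  obtain ⟨K₂, hK₂⟩ := exists_tame_convolution ht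
  refine ⟨K₁ + K₂, fun F A A' hF hF' n ↦ ?_⟩
  induction n with
  | zero => exact ⟨hF.mono (by simp), hF'.mono (by simp)⟩
  | succ n ih =>
    refine ⟨(hK₁ _ _ _ _ hF ih.1).mono ?_, (hK₂ _ _ _ _ _ _ hF ih.1 hF' ih.2).mono ?_⟩
    · calc K₁ * A * (((K₁ + K₂) * A) ^ n * A)
          ≤ (K₁ + K₂) * A * (((K₁ + K₂) * A) ^ n * A) := by gcongr; exact le_self_add
        _ = _ := by ring
    · calc K₂ * (A' * (((K₁ + K₂) * A) ^ n * A) + A * ((n + 1) * ((K₁ + K₂) * A) ^ n * A'))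
          ≤ (K₁ + K₂) *
            (A' * (((K₁ + K₂) * A) ^ n * A) + A * ((n + 1) * ((K₁ + K₂) * A) ^ n * A')) := by
            gcongr
            exact le_add_self
        _ = _ := by push_cast; ring

theorem WeightedBound.sum_inv_factorial_smul {m : E d → ℝ} (hm : Measurable m) {S : ℕ → E d → ℂ}
    {x A : ℝ≥0} (h : ∀ n, WeightedBound m (S n) ((n + 1) * x ^ n * A)) (N : ℕ) :
    WeightedBound m (∑ n ∈ Finset.range N, ((n + 1).factorial : ℂ)⁻¹ • S n)
      ((Real.exp x).toNNReal * A) := by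
  refine (WeightedBound.sum _ (fun n _ ↦ (h n).smul _) hm).mono ?_
  calc ∑ n ∈ Finset.range N, ‖((n + 1).factorial : ℂ)⁻¹‖₊ * ((n + 1) * x ^ n * A)
      = (∑ n ∈ Finset.range N, x ^ n / (n.factorial : ℝ≥0)) * A := by
        rw [Finset.sum_mul]
        refine Finset.sum_congr rfl fun n _ ↦ ?_
        rw [nnnorm_inv, RCLike.nnnorm_natCast, Nat.factorial_succ]
        push_cast
        field_simp
    _ ≤ (Real.exp x).toNNReal * A := by
        gcongr
        rw [← NNReal.coe_le_coe, Real.coe_toNNReal _ (Real.exp_pos _).le]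
        push_cast
        exact Real.sum_le_exp_of_nonneg x.2 N

theorem norm_exp_sub_sum_range_succ_le (z : ℂ) (N : ℕ) :
    ‖Complex.exp z - ∑ n ∈ Finset.range (N + 1), z ^ n / n.factorial‖ ≤
      ‖z‖ * Real.exp ‖z‖ := by
  have hone : (1 : ℝ) ≤ ∑ n ∈ Finset.range (N + 1), ‖z‖ ^ n / n.factorial := by
    rw [Finset.sum_range_succ']
    simpa using Finset.sum_nonneg fun n _ ↦
      (by positivity : 0 ≤ ‖z‖ ^ (n + 1) / (n + 1).factorial)
  have hexp : Real.exp ‖z‖ - 1 ≤ ‖z‖ * Real.exp ‖z‖ := by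
    have hmul := mul_le_mul_of_nonneg_right (Real.add_one_le_exp (-‖z‖)) (Real.exp_pos ‖z‖).le
    rw [← Real.exp_add, neg_add_cancel, Real.exp_zero] at hmul
    linarith
  linarith [Complex.norm_exp_sub_sum_le_exp_norm_sub_sum z (N + 1)]

theorem sum_inv_factorial_smul_sub_exp_sub_one (z : ℂ) (N : ℕ) :
    ∑ n ∈ Finset.range N, ((n + 1).factorial : ℂ)⁻¹ * z ^ (n + 1) - (Complex.exp z - 1) =
      -(Complex.exp z - ∑ n ∈ Finset.range (N + 1), z ^ n / n.factorial) := by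
  rw [Finset.sum_range_succ']
  simp only [div_eq_inv_mul, pow_zero, Nat.factorial_zero, Nat.cast_one, inv_one, mul_one]
  ring

theorem aemeasurable_of_memLp_ofReal {φ : E d → ℝ} {p : ℝ≥0∞}
    (hφ : MemLp (fun x ↦ (φ x : ℂ)) p volume) : AEMeasurable φ volume :=
  Complex.measurable_re.comp_aemeasurable hφ.1.aemeasurable

theorem tendsto_eLpNorm_expSeries_sub {φ : E d → ℝ} {M : ℝ} {p : ℝ≥0∞} (hp : p ≠ 0) (hp' : p ≠ ∞)
    (hφ : MemLp (fun x ↦ (φ x : ℂ)) p volume) (hM : ∀ᵐ x, |φ x| ≤ M) :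
    Tendsto (fun N : ℕ ↦ eLpNorm ((∑ n ∈ Finset.range N,
        ((n + 1).factorial : ℂ)⁻¹ • fun x ↦ (φ x : ℂ) ^ (n + 1)) -
        fun x ↦ ((Real.exp (φ x) - 1 : ℝ) : ℂ)) p volume) atTop (𝓝 0) := by
  have hφm := aemeasurable_of_memLp_ofReal hφ
  have hremainder : ∀ N, ((∑ n ∈ Finset.range N, ((n + 1).factorial : ℂ)⁻¹ • fun x ↦
      (φ x : ℂ) ^ (n + 1)) - fun x ↦ ((Real.exp (φ x) - 1 : ℝ) : ℂ)) = fun x ↦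
      -(Complex.exp (φ x) - ∑ n ∈ Finset.range (N + 1), (φ x : ℂ) ^ n / n.factorial) := by
    refine fun N ↦ funext fun x ↦ ?_
    rw [← sum_inv_factorial_smul_sub_exp_sub_one]
    simp
  simp only [hremainder]
  refine tendsto_eLpNorm_zero_of_dominated hp hp'
    (fun N ↦ AEMeasurable.aestronglyMeasurable (by fun_prop))
    (hφ.norm.mul_const (Real.exp M)) (fun N ↦ ?_) (.of_forall fun x ↦ ?_)
  · filter_upwards [hM] with x hx
    rw [norm_neg]
    refine (norm_exp_sub_sum_range_succ_le _ N).trans ?_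
    gcongr
    rwa [Complex.norm_real]
  · have hsum := (NormedSpace.expSeries_div_hasSum_exp (φ x : ℂ)).tendsto_sum_nat
    rw [← Complex.exp_eq_exp_ℂ] at hsum
    simpa using (((tendsto_add_atTop_iff_nat 1).2 hsum).const_sub (Complex.exp (φ x))).neg

theorem memLp_exp_sub_one {φ : E d → ℝ} {M : ℝ} {p : ℝ≥0∞}
    (hφ : MemLp (fun x ↦ (φ x : ℂ)) p volume) (hM : ∀ᵐ x, |φ x| ≤ M) :
    MemLp (fun x ↦ ((Real.exp (φ x) - 1 : ℝ) : ℂ)) p volume := by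
  have hφm := aemeasurable_of_memLp_ofReal hφ
  refine (hφ.norm.mul_const (Real.exp M)).mono'
    (AEMeasurable.aestronglyMeasurable (by fun_prop)) ?_
  filter_upwards [hM] with x hx
  have hzero := norm_exp_sub_sum_range_succ_le (φ x) 0
  calc ‖((Real.exp (φ x) - 1 : ℝ) : ℂ)‖ ≤ ‖(φ x : ℂ)‖ * Real.exp ‖(φ x : ℂ)‖ := by
        simpa [-Complex.norm_real] using hzero
    _ ≤ ‖(φ x : ℂ)‖ * Real.exp M := by
        gcongr
        rwa [Complex.norm_real]

theorem exists_exp_sub_one {t : ℝ} (ht : (d : ℝ) / 2 < t) (A : ℝ≥0) :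
    ∃ C M : ℝ≥0, ∀ (φ : E d → ℝ) (Φ : E d → ℂ) (A' : ℝ≥0), IsFourierPair (fun x ↦ (φ x : ℂ)) Φ →
      WeightedBound (besselWeight t) Φ A → WeightedBound (besselWeight (t + 1)) Φ A' →
      (∀ᵐ x, |φ x| ≤ M) ∧ ∃ B, IsFourierPair (fun x ↦ ((Real.exp (φ x) - 1 : ℝ) : ℂ)) B ∧
        WeightedBound (besselWeight t) B C ∧ WeightedBound (besselWeight (t + 1)) B (C * A') := by
  obtain ⟨K, hK⟩ := exists_weightedBound_convPow (d := d) ht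
  obtain ⟨L, hL⟩ := (admissibleWeight_besselWeight (d := d) t).exists_integral_norm_le ht
  set c : ℝ≥0 := (Real.exp (K * A : ℝ≥0)).toNNReal
  refine ⟨c * (A + 1), L * A, fun φ Φ A' hφ hA hA' ↦ ?_⟩
  obtain ⟨hint, hnorm⟩ := hL Φ A hA
  have hbounded : ∀ᵐ x, |φ x| ≤ (L * A : ℝ≥0) := by
    filter_upwards [hφ.ae_norm_le_integral_norm hint] with y hy
    rw [Complex.norm_real] at hy
    exact hy.trans hnorm
  have hconvPow := hK Φ A A' hA hA'
  have hpow := hφ.pow_succ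
    (fun n ↦ (hconvPow n).1.integrable (admissibleWeight_besselWeight t) ht)
    fun n ↦ (hconvPow n).1.memLp (by linarith [d.cast_nonneg (α := ℝ)])
  obtain ⟨B, hB⟩ := IsFourierPair.exists_fourier (memLp_exp_sub_one hφ.memLp hbounded)
  have hlim : Tendsto (fun N ↦ eLpNorm ((∑ n ∈ Finset.range N,
      ((n + 1).factorial : ℂ)⁻¹ • convPow Φ n) - B) 2 volume) atTop (𝓝 0) :=
    (tendsto_eLpNorm_expSeries_sub two_ne_zero ENNReal.ofNat_ne_top hφ.memLp hbounded).congr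
      fun N ↦ ((IsFourierPair.sum _ fun n _ ↦ (hpow n).smul _).sub hB).eLpNorm_eq
  refine ⟨hbounded, B, hB, ?_, ?_⟩
  · refine .of_tendsto (fun N ↦ (WeightedBound.sum_inv_factorial_smul (x := K * A) (A := A)
      (by fun_prop) (fun n ↦ (hconvPow n).1.mono ?_) N).mono ?_) hB.memLp_fourier.1 (by fun_prop)
      hlim
    · gcongr
      exact le_mul_of_one_le_left' le_add_self
    · gcongr
      exact le_self_add
  · refine .of_tendsto (fun N ↦ (WeightedBound.sum_inv_factorial_smul (x := K * A) (A := A')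
      (by fun_prop) (fun n ↦ (hconvPow n).2) N).mono ?_) hB.memLp_fourier.1 (by fun_prop) hlim
    gcongr
    exact le_mul_of_one_le_right' le_add_self

theorem norm_derivSymbol_le (i : Fin d) (ξ : E d) : ‖derivSymbol i ξ‖ ≤ ‖(2 * Real.pi) • ξ‖ := by
  have hcoord : ‖derivSymbol i ξ‖ = ‖((2 * Real.pi) • ξ) i‖ := by
    simp [derivSymbol]
  rw [hcoord]
  exact PiLp.norm_apply_le _ i

theorem sum_derivSymbol_sq (ξ : E d) :
    ∑ i, derivSymbol i ξ ^ 2 = -((‖(2 * Real.pi) • ξ‖ ^ 2 : ℝ) : ℂ) := by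
  rw [EuclideanSpace.norm_sq_eq]
  push_cast
  rw [← Finset.sum_neg_distrib]
  refine Finset.sum_congr rfl fun i _ ↦ ?_
  rw [← Complex.ofReal_pow, Real.norm_eq_abs, sq_abs, PiLp.smul_apply, smul_eq_mul, derivSymbol]
  push_cast
  linear_combination (4 * (Real.pi : ℂ) ^ 2 * (ξ i : ℂ) ^ 2) * Complex.I_sq

theorem conj_derivSymbol (i : Fin d) (ξ : E d) :
    (starRingEnd ℂ) (derivSymbol i ξ) = -derivSymbol i ξ := by
  simp [derivSymbol, Complex.conj_ofNat]

@[fun_prop]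
theorem continuous_derivSymbol (i : Fin d) : Continuous (derivSymbol i : E d → ℂ) := by
  unfold derivSymbol; fun_prop

theorem aestronglyMeasurable_derivMul {F : E d → ℂ} (hF : AEStronglyMeasurable F volume)
    (i : Fin d) : AEStronglyMeasurable (derivMul i F) volume :=
  (continuous_derivSymbol i).aestronglyMeasurable.mul hF

theorem norm_sq_mul_eq_div_add_curl (X : Fin d → ℂ) (ξ : E d) (j : Fin d) :
    ((‖(2 * Real.pi) • ξ‖ ^ 2 : ℝ) : ℂ) * X j =
      -(derivSymbol j ξ * ∑ k, derivSymbol k ξ * X k) -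
        ∑ i, derivSymbol i ξ * (derivSymbol i ξ * X j - derivSymbol j ξ * X i) := by
  have hsq : ((‖(2 * Real.pi) • ξ‖ ^ 2 : ℝ) : ℂ) = -∑ i, derivSymbol i ξ ^ 2 := by
    rw [sum_derivSymbol_sq, neg_neg]
  rw [hsq, Finset.mul_sum, neg_mul, Finset.sum_mul, ← Finset.sum_neg_distrib,
    ← Finset.sum_neg_distrib, ← Finset.sum_sub_distrib]
  exact Finset.sum_congr rfl fun i _ ↦ by ring

theorem norm_mul_le_div_add_curl (X : Fin d → ℂ) (ξ : E d) (j : Fin d) :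
    ‖(2 * Real.pi) • ξ‖ * ‖X j‖ ≤ ‖∑ k, derivSymbol k ξ * X k‖ +
      ∑ i, ‖derivSymbol i ξ * X j - derivSymbol j ξ * X i‖ := by
  have hsq := norm_sq_mul_eq_div_add_curl X ξ j
  set n := ‖(2 * Real.pi) • ξ‖ with hn
  rcases (hn ▸ norm_nonneg _ : 0 ≤ n).eq_or_lt with hzero | hpos
  · rw [← hzero, zero_mul]
    positivity
  refine le_of_mul_le_mul_left ?_ hpos
  calc n * (n * ‖X j‖) = ‖((n ^ 2 : ℝ) : ℂ) * X j‖ := by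
        rw [norm_mul, Complex.norm_real, Real.norm_of_nonneg (by positivity)]
        ring
    _ ≤ ‖derivSymbol j ξ‖ * ‖∑ k, derivSymbol k ξ * X k‖ +
        ∑ i, ‖derivSymbol i ξ‖ * ‖derivSymbol i ξ * X j - derivSymbol j ξ * X i‖ := by
        rw [hsq]
        simp only [← norm_mul]
        refine (norm_sub_le _ _).trans ?_
        rw [norm_neg]
        gcongr
        exact norm_sum_le _ _
    _ ≤ n * ‖∑ k, derivSymbol k ξ * X k‖ +
        ∑ i, n * ‖derivSymbol i ξ * X j - derivSymbol j ξ * X i‖ := by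
        gcongr <;> exact norm_derivSymbol_le _ _
    _ = _ := by rw [mul_add, Finset.mul_sum]

namespace WeightedBound

variable {F : E d → ℂ} {A B : ℝ≥0} {a b : ℝ}

theorem gradWeight_of_besselWeight (h : WeightedBound (besselWeight (b + 1)) F A) :
    WeightedBound (gradWeight b) F A := by
  refine h.of_le h.1 (.of_forall fun ξ ↦ ?_)
  rw [norm_besselWeight_mul, norm_gradWeight_mul]
  gcongr
  exact gradWeight_le_besselWeight b ξ

theorem gradWeight_anti (h : WeightedBound (gradWeight b) F A) (hab : a ≤ b) :
    WeightedBound (gradWeight a) F A := by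
  refine h.of_le h.1 (.of_forall fun ξ ↦ ?_)
  simp only [norm_gradWeight_mul]
  gcongr
  exact gradWeight_mono hab ξ

theorem derivMul_of_gradWeight (h : WeightedBound (gradWeight b) F A)
    (i : Fin d) : WeightedBound (besselWeight b) (derivMul i F) A := by
  refine h.of_le (aestronglyMeasurable_derivMul h.1 i) (.of_forall fun ξ ↦ ?_)
  rw [norm_gradWeight_mul, norm_besselWeight_mul, gradWeight, derivMul,
    norm_mul, mul_comm ‖_ • ξ‖, mul_assoc]
  have := besselWeight_pos b ξ
  gcongr
  exact norm_derivSymbol_le i ξ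

theorem derivMul_of_besselWeight (h : WeightedBound (besselWeight (b + 1)) F A) (i : Fin d) :
    WeightedBound (besselWeight b) (derivMul i F) A :=
  h.gradWeight_of_besselWeight.derivMul_of_gradWeight i

theorem gradWeight_of_div_curl {X : Fin d → E d → ℂ}
    (hX : ∀ j, AEStronglyMeasurable (X j) volume)
    (hdiv : WeightedBound (besselWeight b) (∑ k, derivMul k (X k)) A)
    (hcurl : ∀ i j, WeightedBound (besselWeight b)
      (derivMul i (X j) - derivMul j (X i)) B)
    (j : Fin d) : WeightedBound (gradWeight b) (X j) (A + d * B) := by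
  have hcurlSum := WeightedBound.sum Finset.univ (fun i _ ↦ (hcurl i j).ofReal_norm)
    (measurable_besselWeight b)
  rw [Finset.sum_const, Finset.card_univ, Fintype.card_fin, nsmul_eq_mul] at hcurlSum
  refine of_le_add hdiv hcurlSum (hX j) (by fun_prop) (by fun_prop) (.of_forall fun ξ ↦ ?_)
  rw [norm_gradWeight_mul, norm_besselWeight_mul, norm_besselWeight_mul, ← mul_add,
    gradWeight, mul_comm ‖_ • ξ‖, mul_assoc, Finset.sum_apply, Finset.sum_apply,
    ← Complex.ofReal_sum, Complex.norm_real, Real.norm_of_nonneg (by positivity)]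
  exact mul_le_mul_of_nonneg_left (norm_mul_le_div_add_curl (fun k ↦ X k ξ) ξ j)
    (besselWeight_pos b ξ).le

end WeightedBound

theorem exists_besselWeight_le_add {a b : ℝ} (ha : 0 ≤ a) (hab : a < b) {ε : ℝ} (hε : 0 < ε) :
    ∃ C : ℝ, 0 ≤ C ∧ ∀ ξ : E d, besselWeight a ξ ≤ ε * besselWeight b ξ + C := by
  set T : ℝ := ε⁻¹ ^ (2 / (b - a)) with hT
  have hba : 0 < b - a := sub_pos.2 hab
  have hC : 0 ≤ T ^ (a / 2) := by positivity
  refine ⟨T ^ (a / 2), hC, fun ξ ↦ ?_⟩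
  have ha' := besselWeight_pos a ξ
  have hb' := besselWeight_pos b ξ
  rcases le_total T (bracketSq ξ) with hhigh | hlow
  · have hε' : ε⁻¹ ≤ besselWeight (b - a) ξ := by
      have hpow := Real.rpow_le_rpow (by positivity) hhigh (by linarith : 0 ≤ (b - a) / 2)
      rwa [hT, ← Real.rpow_mul (by positivity), show 2 / (b - a) * ((b - a) / 2) = 1 by field_simp,
        Real.rpow_one] at hpow
    calc besselWeight a ξ = ε * (ε⁻¹ * besselWeight a ξ) := by field_simp
      _ ≤ ε * (besselWeight (b - a) ξ * besselWeight a ξ) := by gcongr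
      _ = ε * besselWeight b ξ := by rw [← besselWeight_add, sub_add_cancel]
      _ ≤ _ := le_add_of_nonneg_right hC
  · calc besselWeight a ξ ≤ T ^ (a / 2) :=
        Real.rpow_le_rpow (bracketSq_pos ξ).le hlow (by positivity)
      _ ≤ _ := le_add_of_nonneg_left (by positivity)

theorem exists_besselWeight_le_gradWeight_add {σ s : ℝ} (hσ : 0 ≤ σ) (hσs : σ < s) (hs : 1 ≤ s)
    {ε : ℝ} (hε : 0 < ε) :
    ∃ C : ℝ≥0, ∀ ξ : E d, besselWeight σ ξ ≤ ε * gradWeight (s - 1) ξ + C := by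
  obtain ⟨C₁, hC₁, h₁⟩ := exists_besselWeight_le_add (d := d) hσ hσs (half_pos hε)
  obtain ⟨C₂, hC₂, h₂⟩ := exists_besselWeight_le_add (d := d) (sub_nonneg.2 hs) (sub_one_lt s)
    one_half_pos
  refine ⟨⟨ε * C₂ + C₁, by positivity⟩, fun ξ ↦ ?_⟩
  have hgrad := besselWeight_le_gradWeight_add (s - 1) ξ
  rw [sub_add_cancel] at hgrad
  have hhalf : besselWeight s ξ ≤ 2 * (gradWeight (s - 1) ξ + C₂) := by linarith [h₂ ξ]
  calc besselWeight σ ξ ≤ ε / 2 * besselWeight s ξ + C₁ := h₁ ξ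
    _ ≤ ε / 2 * (2 * (gradWeight (s - 1) ξ + C₂)) + C₁ := by gcongr
    _ = ε * gradWeight (s - 1) ξ + (ε * C₂ + C₁) := by ring

theorem WeightedBound.exists_interpolation {σ s : ℝ} (hσ : 0 ≤ σ) (hσs : σ < s) (hs : 1 ≤ s)
    {ε : ℝ≥0} (hε : 0 < ε) :
    ∃ C : ℝ≥0, ∀ (F : E d → ℂ) (A B : ℝ≥0), WeightedBound (gradWeight (s - 1)) F A →
      WeightedBound (besselWeight 0) F B → WeightedBound (besselWeight σ) F (ε * A + C * B) := by
  obtain ⟨C, hC⟩ := exists_besselWeight_le_gradWeight_add (d := d) hσ hσs hs (ε := ε) hε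
  refine ⟨C, fun F A B hA hB ↦ ?_⟩
  have hnn : ∀ c : ℝ≥0, ‖((c : ℝ) : ℂ)‖₊ = c := fun c ↦ by ext; simp
  rw [← hnn ε, ← hnn C]
  refine .of_le_add (hA.smul _) (hB.smul _) hA.1 (by fun_prop) (by fun_prop)
    (.of_forall fun ξ ↦ ?_)
  simp only [norm_besselWeight_mul, norm_gradWeight_mul, Pi.smul_apply, norm_smul,
    Complex.norm_real, NNReal.norm_eq]
  rw [besselWeight_zero]
  calc besselWeight σ ξ * ‖F ξ‖ ≤ (ε * gradWeight (s - 1) ξ + C) * ‖F ξ‖ := by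
        gcongr
        exact hC ξ
    _ = _ := by ring

/-- The function `-Δ⁻¹ div W` on the Fourier side. -/
def potential (W : Fin d → E d → ℂ) (ξ : E d) : ℂ :=
  ((‖(2 * Real.pi) • ξ‖ ^ 2 : ℝ) : ℂ)⁻¹ * ∑ k, derivMul k (W k) ξ

/-- The field `-∇ Δ⁻¹ div W` on the Fourier side: minus the gradient part of `W` in its Helmholtz
decomposition. -/
def gradPart (W : Fin d → E d → ℂ) (j : Fin d) (ξ : E d) : ℂ := derivSymbol j ξ * potential W ξ

theorem sum_derivMul_gradPart (W : Fin d → E d → ℂ) (ξ : E d) :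
    ∑ j, derivMul j (gradPart W j) ξ = -∑ k, derivMul k (W k) ξ := by
  simp only [derivMul, gradPart, ← mul_assoc, ← Finset.sum_mul, ← sq]
  rw [sum_derivSymbol_sq, potential]
  by_cases hξ : ‖(2 * Real.pi) • ξ‖ = 0
  · have hsymbol : ∀ k : Fin d, derivSymbol k ξ = 0 := fun k ↦
      norm_le_zero_iff.1 ((norm_derivSymbol_le k ξ).trans hξ.le)
    simp [derivMul, hsymbol]
  · have hne : ((‖(2 * Real.pi) • ξ‖ ^ 2 : ℝ) : ℂ) ≠ 0 := by
      exact_mod_cast pow_ne_zero 2 hξ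
    rw [neg_mul, mul_inv_cancel_left₀ hne]
    rfl

theorem derivMul_gradPart_comm (W : Fin d → E d → ℂ) (i j : Fin d) :
    derivMul i (gradPart W j) = derivMul j (gradPart W i) := by
  ext ξ
  exact mul_left_comm _ _ _

theorem norm_gradPart_le (W : Fin d → E d → ℂ) (j : Fin d) (ξ : E d) :
    ‖gradPart W j ξ‖ ≤ ∑ k, ‖W k ξ‖ := by
  set n := ‖(2 * Real.pi) • ξ‖ with hn
  rw [gradPart, potential, norm_mul, norm_mul, norm_inv, Complex.norm_real, ← hn,
    Real.norm_of_nonneg (sq_nonneg n)]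
  calc ‖derivSymbol j ξ‖ * ((n ^ 2)⁻¹ * ‖∑ k, derivMul k (W k) ξ‖)
      ≤ n * ((n ^ 2)⁻¹ * ∑ k, n * ‖W k ξ‖) := by
        gcongr
        · exact norm_derivSymbol_le j ξ
        · refine norm_sum_le_of_le _ fun k _ ↦ ?_
          rw [derivMul, norm_mul]
          gcongr
          exact norm_derivSymbol_le k ξ
    _ = n ^ 2 / n ^ 2 * ∑ k, ‖W k ξ‖ := by rw [← Finset.mul_sum]; ring
    _ ≤ ∑ k, ‖W k ξ‖ := mul_le_of_le_one_left (by positivity) (div_self_le_one _)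

theorem aestronglyMeasurable_gradPart {W : Fin d → E d → ℂ}
    (hW : ∀ k, AEStronglyMeasurable (W k) volume) (j : Fin d) :
    AEStronglyMeasurable (gradPart W j) volume := by
  refine (continuous_derivSymbol j).aestronglyMeasurable.mul (AEStronglyMeasurable.mul ?_ ?_)
  · exact Measurable.aestronglyMeasurable (by fun_prop)
  · exact Finset.aestronglyMeasurable_fun_sum _ fun k _ ↦ aestronglyMeasurable_derivMul (hW k) k

theorem memLp_gradPart {W : Fin d → E d → ℂ} (hW : ∀ k, MemLp (W k) 2 volume) (j : Fin d) :
    MemLp (gradPart W j) 2 volume := by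
  have hsum : MemLp (fun ξ ↦ ∑ k, ‖W k ξ‖) 2 volume :=
    memLp_finsetSum _ fun k _ ↦ (hW k).norm
  refine hsum.mono (aestronglyMeasurable_gradPart (fun k ↦ (hW k).1) j) (.of_forall fun ξ ↦ ?_)
  exact (norm_gradPart_le W j ξ).trans (le_abs_self _)

section Energy

theorem integral_norm_sq_eq {X F : Type*} [MeasurableSpace X] {μ : Measure X}
    [NormedAddCommGroup F] {f : X → F} (hf : MemLp f 2 μ) :
    ∫ x, ‖f x‖ ^ 2 ∂μ = (eLpNorm f 2 μ).toReal ^ 2 := by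
  have hnonneg : 0 ≤ ∫ x, ‖f x‖ ^ 2 ∂μ := by positivity
  rw [hf.eLpNorm_eq_integral_rpow_norm (by norm_num) (by norm_num),
    ENNReal.toReal_ofReal (by positivity)]
  simp only [ENNReal.toReal_ofNat, Real.rpow_two]
  rw [← Real.rpow_mul_natCast hnonneg]
  norm_num

theorem integral_norm_mul_norm_le {X F G : Type*} [MeasurableSpace X] {μ : Measure X}
    [NormedAddCommGroup F] [NormedAddCommGroup G] {f : X → F} {g : X → G}
    (hf : MemLp f 2 μ) (hg : MemLp g 2 μ) :
    ∫ x, ‖f x‖ * ‖g x‖ ∂μ ≤ (eLpNorm f 2 μ).toReal * (eLpNorm g 2 μ).toReal := by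
  have hHolder := eLpNorm_smul_le_mul_eLpNorm (p := 2) (q := 2) (r := 1) hg.norm.1 hf.norm.1
  rw [eLpNorm_norm, eLpNorm_norm] at hHolder
  have hint : ∫ x, ‖f x‖ * ‖g x‖ ∂μ =
      (eLpNorm ((fun x ↦ ‖f x‖) • fun x ↦ ‖g x‖) 1 μ).toReal := by
    rw [eLpNorm_one_eq_lintegral_enorm, ← integral_norm_eq_lintegral_enorm
      (hf.norm.1.smul hg.norm.1)]
    simp
  rw [hint, ← ENNReal.toReal_mul]
  exact ENNReal.toReal_mono (ENNReal.mul_ne_top hf.2.ne hg.2.ne) hHolder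

theorem IsFourierPair.weightedNorm_besselWeight_zero {f F : E d → ℂ} (h : IsFourierPair f F) :
    weightedNorm (besselWeight 0) F = eLpNorm f 2 volume := by
  rw [h.eLpNorm_eq, weightedNorm]
  simp [besselWeight_zero]

-- Gradients are orthogonal to divergence-free fields, and `gradPart W + W` is divergence free.
theorem sum_integral_add_mul_conj_gradPart {f u W : Fin d → E d → ℂ}
    (hW : ∀ j, IsFourierPair (f j) (W j)) (hu : ∀ j, IsFourierPair (u j) (gradPart W j)) :
    ∑ j, ∫ x, (u j x + f j x) * (starRingEnd ℂ) (u j x) = 0 := by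
  have hparseval : ∀ j, ∫ x, (u j x + f j x) * (starRingEnd ℂ) (u j x)
      = ∫ ξ, (gradPart W j ξ + W j ξ) * (starRingEnd ℂ) (gradPart W j ξ) := fun j ↦
    ((hu j).add (hW j)).integral_mul_conj (hu j)
  have hfactor : ∀ ξ j, (gradPart W j ξ + W j ξ) * (starRingEnd ℂ) (gradPart W j ξ)
      = -(starRingEnd ℂ) (potential W ξ) *
        (derivMul j (gradPart W j) ξ + derivMul j (W j) ξ) := fun ξ j ↦ by
    have hconj : (starRingEnd ℂ) (gradPart W j ξ) =
        -derivSymbol j ξ * (starRingEnd ℂ) (potential W ξ) := by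
      rw [gradPart, map_mul, conj_derivSymbol]
    rw [hconj, derivMul, derivMul]
    ring
  simp only [hparseval]
  have hint : ∀ j, Integrable fun ξ ↦
      (gradPart W j ξ + W j ξ) * (starRingEnd ℂ) (gradPart W j ξ) := fun j ↦
    ((hu j).memLp_fourier.add (hW j).memLp_fourier).integrable_mul (hu j).memLp_fourier.star
  rw [← integral_finsetSum _ fun j _ ↦ hint j]
  refine integral_eq_zero_of_ae (.of_forall fun ξ ↦ ?_)
  simp only [hfactor]
  rw [← Finset.mul_sum, Finset.sum_add_distrib, sum_derivMul_gradPart, neg_add_cancel, mul_zero,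
    Pi.zero_apply]

theorem mul_norm_sq_sub_le_re_add_mul_conj {a ρ P : ℝ} {u v : ℂ} (hρ : ρ ≤ 1 + a)
    (hP : ‖v - u‖ ≤ P) :
    ρ * ‖u‖ ^ 2 - P * (‖(a : ℂ)‖ * ‖u‖) ≤ ((u + a * v) * (starRingEnd ℂ) u).re := by
  have hsplit : (u + a * v) * (starRingEnd ℂ) u =
      ((1 + a) * ‖u‖ ^ 2 : ℝ) + a * ((v - u) * (starRingEnd ℂ) u) := by
    push_cast
    rw [← Complex.mul_conj']
    ring
  have herror : ‖(a : ℂ) * ((v - u) * (starRingEnd ℂ) u)‖ ≤ P * (‖(a : ℂ)‖ * ‖u‖) := by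
    rw [norm_mul, norm_mul, RCLike.norm_conj, mul_left_comm]
    gcongr
  have hre := neg_le_of_abs_le ((Complex.abs_re_le_norm _).trans herror)
  have hmain : ρ * ‖u‖ ^ 2 ≤ (1 + a) * ‖u‖ ^ 2 := by gcongr
  rw [hsplit, Complex.add_re, Complex.ofReal_re]
  linarith

theorem le_re_integral_add_mul_conj {α : E d → ℝ} {ρ P : ℝ} {u v : E d → ℂ} (hP₀ : 0 ≤ P)
    (hα : MemLp (fun x ↦ (α x : ℂ)) 2 volume) (hu : MemLp u 2 volume)
    (hαv : MemLp (fun x ↦ α x * v x) 2 volume)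
    (hρ : ∀ᵐ x, ρ ≤ 1 + α x) (hP : ∀ᵐ x, ‖v x - u x‖ ≤ P) :
    ρ * (eLpNorm u 2 volume).toReal ^ 2 -
        P * ((eLpNorm (fun x ↦ (α x : ℂ)) 2 volume).toReal * (eLpNorm u 2 volume).toReal) ≤
      (∫ x, (u x + α x * v x) * (starRingEnd ℂ) (u x)).re := by
  have hint : Integrable fun x ↦ (u x + α x * v x) * (starRingEnd ℂ) (u x) :=
    (hu.add hαv).integrable_mul hu.star
  have hsq : Integrable fun x ↦ ‖u x‖ ^ 2 := hu.integrable_norm_pow (by norm_num)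
  have hmul : Integrable fun x ↦ ‖(α x : ℂ)‖ * ‖u x‖ := hα.norm.integrable_mul hu.norm
  have hre : (∫ x, (u x + α x * v x) * (starRingEnd ℂ) (u x)).re =
      ∫ x, ((u x + α x * v x) * (starRingEnd ℂ) (u x)).re := (integral_re hint).symm
  calc _ ≤ ρ * (∫ x, ‖u x‖ ^ 2) - P * ∫ x, ‖(α x : ℂ)‖ * ‖u x‖ := by
        rw [integral_norm_sq_eq hu]
        gcongr
        exact integral_norm_mul_norm_le hα hu
    _ = ∫ x, (ρ * ‖u x‖ ^ 2 - P * (‖(α x : ℂ)‖ * ‖u x‖)) := by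
        rw [integral_sub (hsq.const_mul _) (hmul.const_mul _), integral_const_mul,
          integral_const_mul]
    _ ≤ _ := by
        rw [hre]
        refine integral_mono_ae ((hsq.const_mul _).sub (hmul.const_mul _)) hint.re ?_
        filter_upwards [hρ, hP] with x hρx hPx
        exact mul_norm_sq_sub_le_re_add_mul_conj hρx hPx

theorem sum_le_of_mul_sum_sq_le {ι : Type*} [Fintype ι] {ℓ : ι → ℝ} (hℓ : ∀ i, 0 ≤ ℓ i)
    {ρ c : ℝ} (hρ : 0 < ρ) (hc : 0 ≤ c) (h : ρ * ∑ i, ℓ i ^ 2 ≤ c * ∑ i, ℓ i) :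
    ∑ i, ℓ i ≤ Fintype.card ι * ρ⁻¹ * c := by
  rcases (Finset.sum_nonneg fun i _ ↦ hℓ i : 0 ≤ ∑ i, ℓ i).eq_or_lt with hzero | hpos
  · rw [← hzero]
    positivity
  refine le_of_mul_le_mul_right ?_ hpos
  calc (∑ i, ℓ i) * ∑ i, ℓ i ≤ Fintype.card ι * ∑ i, ℓ i ^ 2 := by
        rw [← sq]
        exact sq_sum_le_card_mul_sum_sq
    _ ≤ Fintype.card ι * (ρ⁻¹ * (c * ∑ i, ℓ i)) := by
        gcongr
        rwa [le_inv_mul_iff₀ hρ]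
    _ = _ := by ring

theorem weightedBound_gradPart_of_norm_sub_le {α : E d → ℝ} {A : E d → ℂ}
    {u v W : Fin d → E d → ℂ} {ρ P a : ℝ≥0} (hA : IsFourierPair (fun x ↦ (α x : ℂ)) A)
    (hAa : WeightedBound (besselWeight 0) A a) (hρ₀ : 0 < ρ) (hρ : ∀ᵐ x, ρ ≤ 1 + α x)
    (hW : ∀ j, IsFourierPair (fun x ↦ α x * v j x) (W j))
    (hu : ∀ j, IsFourierPair (u j) (gradPart W j)) (hP : ∀ j, ∀ᵐ x, ‖v j x - u j x‖ ≤ P)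
    (j : Fin d) : WeightedBound (besselWeight 0) (gradPart W j) (d * ρ⁻¹ * (P * a)) := by
  set ℓ : Fin d → ℝ := fun j ↦ (eLpNorm (u j) 2 volume).toReal
  have hℓ₀ : ∀ j, 0 ≤ ℓ j := fun j ↦ ENNReal.toReal_nonneg
  have hαa : (eLpNorm (fun x ↦ (α x : ℂ)) 2 volume).toReal ≤ a := by
    rw [← hA.weightedNorm_besselWeight_zero]
    exact ENNReal.toReal_le_coe_of_le_coe hAa.2
  have henergy : ρ * ∑ j, ℓ j ^ 2 ≤ P * a * ∑ j, ℓ j := by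
    have hsum := congrArg Complex.re (sum_integral_add_mul_conj_gradPart hW hu)
    rw [Complex.re_sum, Complex.zero_re] at hsum
    have hle := Finset.sum_le_sum fun j (_ : j ∈ Finset.univ) ↦
      le_re_integral_add_mul_conj P.coe_nonneg hA.memLp (hu j).memLp (hW j).memLp hρ (hP j)
    rw [hsum, Finset.sum_sub_distrib, ← Finset.mul_sum, ← Finset.mul_sum, ← Finset.mul_sum,
      sub_nonpos] at hle
    refine hle.trans ?_
    rw [← mul_assoc]
    have := Finset.sum_nonneg fun i (_ : i ∈ Finset.univ) ↦ hℓ₀ i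
    gcongr
  have hsum := sum_le_of_mul_sum_sq_le hℓ₀ hρ₀ (by positivity) henergy
  rw [Fintype.card_fin] at hsum
  refine ⟨(hu j).memLp_fourier.1, ?_⟩
  rw [(hu j).weightedNorm_besselWeight_zero, ← ENNReal.ofReal_coe_nnreal]
  refine (ENNReal.le_ofReal_iff_toReal_le (hu j).memLp.2.ne (by positivity)).2 ?_
  push_cast
  exact (Finset.single_le_sum (fun j _ ↦ hℓ₀ j) (Finset.mem_univ j)).trans hsum

end Energy

section WeightedDivCurl

theorem integrable_of_besselWeight {t : ℝ} {F : E d → ℂ} {a : ℝ≥0} (ht : (d : ℝ) / 2 < t)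
    (hF : WeightedBound (besselWeight t) F a) : Integrable F :=
  hF.integrable (admissibleWeight_besselWeight t) ht

theorem IsFourierPair.mul_of_weightedBound {t : ℝ} {f g F G : E d → ℂ} {a b : ℝ≥0}
    (ht : (d : ℝ) / 2 < t) (hf : IsFourierPair f F) (hg : IsFourierPair g G)
    (hF : WeightedBound (besselWeight t) F a) (hG : WeightedBound (besselWeight t) G b) :
    IsFourierPair (f * g) (F ⋆ₘ G) := by
  have ht₀ : 0 ≤ t := le_trans (by positivity) ht.le
  obtain ⟨K, hK⟩ := (admissibleWeight_besselWeight (d := d) t).exists_weightedBound_convolution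
    ht₀ le_rfl ht
  exact hf.mul hg (integrable_of_besselWeight ht hF) (integrable_of_besselWeight ht hG)
    ((hK _ _ _ _ hF hG).memLp ht₀)

theorem convolution_add_right {F G H : E d → ℂ} (hF : Integrable F) (hG : Integrable G)
    (hH : Integrable H) : F ⋆ₘ (G + H) =ᵐ[volume] F ⋆ₘ G + F ⋆ₘ H := by
  filter_upwards [hF.ae_convolution_exists (ContinuousLinearMap.mul ℂ ℂ) hG,
    hF.ae_convolution_exists (ContinuousLinearMap.mul ℂ ℂ) hH] with ξ hFG hFH
  exact hFG.distrib_add hFH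

theorem convolution_sum_right {ι : Type*} (s : Finset ι) {F : E d → ℂ} {G : ι → E d → ℂ}
    (hF : Integrable F) (hG : ∀ i ∈ s, Integrable (G i)) :
    F ⋆ₘ (∑ i ∈ s, G i) =ᵐ[volume] ∑ i ∈ s, F ⋆ₘ G i := by
  have hexists : ∀ᵐ ξ, ∀ i ∈ s, ConvolutionExistsAt F (G i) ξ (ContinuousLinearMap.mul ℂ ℂ) :=
    (ae_ball_iff s.countable_toSet).2 fun i hi ↦ hF.ae_convolution_exists _ (hG i hi)
  filter_upwards [hexists] with ξ hξ
  simp only [Finset.sum_apply, convolution_def, map_sum]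
  exact integral_finsetSum _ hξ

/-- Two weights `1 + α` and `1 + β` inverse to each other, together with bounds on the Fourier
transforms `A` and `B` of `α` and `β`. They are `e ^ φ` and `e ^ (-φ)` in the application. -/
structure InverseWeights (s : ℝ) (α β : E d → ℝ) (A B : E d → ℂ) (ρ C C' : ℝ≥0) : Prop where
  mul_eq_one : ∀ x, (1 + α x) * (1 + β x) = 1
  le_one_add : ∀ᵐ x, ρ ≤ 1 + α x
  left : IsFourierPair (fun x ↦ (α x : ℂ)) A
  right : IsFourierPair (fun x ↦ (β x : ℂ)) B
  left_bound : WeightedBound (besselWeight s) A C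
  right_bound : WeightedBound (besselWeight s) B C
  right_bound_succ : WeightedBound (besselWeight (s + 1)) B C'

/-- A field `v` with Fourier transform `V` such that `curl v` and the divergence of `(1 + α) v`,
whose Fourier transform is `G`, are bounded by `δ` in `H ^ s`. The `H ^ (s + 1)` norms of both
fields are only required to be finite. -/
structure DivCurlBound (s : ℝ) (α : E d → ℝ) (v V G : Fin d → E d → ℂ) (δ : ℝ≥0) : Prop where
  field : ∀ j, IsFourierPair (v j) (V j)
  weighted : ∀ j, IsFourierPair (fun x ↦ ((1 + α x : ℝ) : ℂ) * v j x) (G j)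
  field_finite : ∀ j, ∃ r, WeightedBound (besselWeight (s + 1)) (V j) r
  weighted_finite : ∀ j, ∃ r, WeightedBound (besselWeight (s + 1)) (G j) r
  div : WeightedBound (besselWeight s) (∑ j, derivMul j (G j)) δ
  curl : ∀ i j, WeightedBound (besselWeight s) (derivMul i (V j) - derivMul j (V i)) δ

theorem exists_inverseWeights_exp {s : ℝ} (hs : (d : ℝ) / 2 < s) (R : ℝ≥0) :
    ∃ C ρ : ℝ≥0, 0 < ρ ∧ ∀ (φ : E d → ℝ) (Φ : E d → ℂ) (R' : ℝ≥0),
      IsFourierPair (fun x ↦ (φ x : ℂ)) Φ → WeightedBound (besselWeight s) Φ R →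
      WeightedBound (besselWeight (s + 1)) Φ R' →
      ∃ A B, InverseWeights s (fun x ↦ Real.exp (φ x) - 1) (fun x ↦ Real.exp (-φ x) - 1) A B
        ρ C (C * R') := by
  obtain ⟨C, M, hexp⟩ := exists_exp_sub_one (d := d) hs R
  refine ⟨C, ⟨Real.exp (-M), (Real.exp_pos _).le⟩, Real.exp_pos _, fun φ Φ R' hφ hR hR' ↦ ?_⟩
  have hφneg : IsFourierPair (fun x ↦ ((-φ x : ℝ) : ℂ)) (-Φ) :=
    hφ.neg.congr (.of_forall fun x ↦ (Complex.ofReal_neg _).symm) ae_eq_rfl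
  obtain ⟨hM, A, hA, hAC, -⟩ := hexp φ Φ R' hφ hR hR'
  obtain ⟨-, B, hB, hBC, hBC'⟩ := hexp (fun x ↦ -φ x) (-Φ) R' hφneg hR.neg hR'.neg
  refine ⟨A, B, fun x ↦ ?_, ?_, hA, hB, hAC, hBC, hBC'⟩
  · rw [add_sub_cancel, add_sub_cancel, ← Real.exp_add, add_neg_cancel, Real.exp_zero]
  · filter_upwards [hM] with x hx
    rw [add_sub_cancel]
    exact Real.exp_le_exp.2 (abs_le.1 hx).1

theorem sum_derivMul_gradPart_ae_eq {α : E d → ℝ} {v V W G : Fin d → E d → ℂ}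
    (hV : ∀ j, IsFourierPair (v j) (V j)) (hW : ∀ j, IsFourierPair (fun x ↦ α x * v j x) (W j))
    (hG : ∀ j, IsFourierPair (fun x ↦ ((1 + α x : ℝ) : ℂ) * v j x) (G j)) :
    (∑ j, derivMul j (gradPart W j)) =ᵐ[volume]
      ∑ j, derivMul j (V j) - ∑ j, derivMul j (G j) := by
  have hsum : ∀ j, G j =ᵐ[volume] V j + W j := fun j ↦ by
    refine (hG j).unique (((hV j).add (hW j)).congr (.of_forall fun x ↦ ?_) ae_eq_rfl)
    simp only [Pi.add_apply, Complex.ofReal_add, Complex.ofReal_one]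
    ring
  filter_upwards [ae_all_iff.2 hsum] with ξ hξ
  simp only [Pi.add_apply] at hξ
  rw [Finset.sum_apply, sum_derivMul_gradPart]
  simp only [Finset.sum_apply, Pi.sub_apply, derivMul, hξ, mul_add, Finset.sum_add_distrib]
  ring

-- `V - gradPart W` has divergence `∑ j, derivMul j (G j)` and the same curl as `V`.
theorem weightedBound_sub_gradPart {s : ℝ} {V W G : Fin d → E d → ℂ} {δ : ℝ≥0}
    (hV : ∀ j, MemLp (V j) 2 volume) (hW : ∀ j, MemLp (W j) 2 volume)
    (hGW : (∑ j, derivMul j (gradPart W j)) =ᵐ[volume]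
      ∑ j, derivMul j (V j) - ∑ j, derivMul j (G j))
    (hdiv : WeightedBound (besselWeight s) (∑ j, derivMul j (G j)) δ)
    (hcurl : ∀ i j, WeightedBound (besselWeight s) (derivMul i (V j) - derivMul j (V i)) δ)
    (j : Fin d) : WeightedBound (gradWeight s) (V j - gradPart W j) (δ + d * δ) := by
  have hsub : ∀ i k, derivMul i (V k - gradPart W k) =
      derivMul i (V k) - derivMul i (gradPart W k) := fun i k ↦ by
    ext ξ
    simp only [derivMul, Pi.sub_apply, mul_sub]
  refine WeightedBound.gradWeight_of_div_curl
    (fun k ↦ (hV k).1.sub (memLp_gradPart hW k).1) (hdiv.congr ?_) (fun i k ↦ ?_) j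
  · filter_upwards [hGW] with ξ hξ
    simp only [hsub, Finset.sum_sub_distrib, Pi.sub_apply] at hξ ⊢
    rw [hξ, sub_sub_cancel]
  · rw [hsub, hsub, derivMul_gradPart_comm W i k, sub_sub_sub_cancel_right]
    exact hcurl i k

theorem InverseWeights.isFourierPair_mul {s : ℝ} (hs : (d : ℝ) / 2 < s) {α β : E d → ℝ}
    {A B : E d → ℂ} {v V G : Fin d → E d → ℂ} {ρ C C' δ : ℝ≥0}
    (h : InverseWeights s α β A B ρ C C') (hv : DivCurlBound s α v V G δ) (j : Fin d) :
    IsFourierPair (fun x ↦ α x * v j x) (A ⋆ₘ V j) := by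
  obtain ⟨r, hr⟩ := hv.field_finite j
  exact h.left.mul_of_weightedBound hs (hv.field j) h.left_bound (hr.anti (by linarith))

theorem exists_gradPart_bounds (hd : 3 ≤ d) {s : ℝ} (hs : (d : ℝ) / 2 < s) {ρ : ℝ≥0} (hρ : 0 < ρ)
    (C : ℝ≥0) :
    ∃ c : ℝ≥0, ∀ (α β : E d → ℝ) (A B : E d → ℂ) (v V G : Fin d → E d → ℂ) (C' δ : ℝ≥0),
      InverseWeights s α β A B ρ C C' → DivCurlBound s α v V G δ → ∀ j,
        WeightedBound (besselWeight 0) (gradPart (fun k ↦ A ⋆ₘ V k) j) (c * δ) ∧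
        WeightedBound (gradWeight s) (V j - gradPart (fun k ↦ A ⋆ₘ V k) j) (c * δ) := by
  obtain ⟨L, hL⟩ := (admissibleWeight_gradWeight hd s).exists_integral_norm_le hs
  refine ⟨d * ρ⁻¹ * (L * (1 + d) * C) + (1 + d), fun α β A B v V G C' δ h hv j ↦ ?_⟩
  have hW := h.isFourierPair_mul hs hv
  choose u hu using fun k ↦
    IsFourierPair.exists_fourierInv (memLp_gradPart (fun k ↦ (hW k).memLp_fourier) k)
  have hdiff := weightedBound_sub_gradPart (fun k ↦ (hv.field k).memLp_fourier)
    (fun k ↦ (hW k).memLp_fourier) (sum_derivMul_gradPart_ae_eq hv.field hW hv.weighted)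
    hv.div hv.curl
  have hsup : ∀ k, ∀ᵐ x, ‖v k x - u k x‖ ≤ (L * (δ + d * δ) : ℝ≥0) := fun k ↦ by
    obtain ⟨hint, hle⟩ := hL _ _ ((hdiff k).gradWeight_anti (sub_one_lt s).le)
    filter_upwards [((hv.field k).sub (hu k)).ae_norm_le_integral_norm hint] with x hx
    exact hx.trans (by exact_mod_cast hle)
  have henergy := weightedBound_gradPart_of_norm_sub_le h.left
    (h.left_bound.anti (le_trans (by positivity) hs.le)) hρ h.le_one_add hW hu hsup j
  exact ⟨henergy.mono (le_of_eq_of_le (by ring) (mul_le_mul_left le_self_add δ)),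
    (hdiff j).mono (le_of_eq_of_le (by ring) (mul_le_mul_left le_add_self δ))⟩

theorem exists_gradPart_bound_interpolated (hd : 3 ≤ d) {σ s : ℝ} (hs : (d : ℝ) / 2 < s)
    (hσ : 0 ≤ σ) (hσs : σ < s) {ρ ε : ℝ≥0} (hρ : 0 < ρ) (hε : 0 < ε) (C : ℝ≥0) :
    ∃ c : ℝ≥0, ∀ (α β : E d → ℝ) (A B : E d → ℂ) (v V G : Fin d → E d → ℂ) (C' δ N : ℝ≥0),
      InverseWeights s α β A B ρ C C' → DivCurlBound s α v V G δ →
      WeightedBound (besselWeight (s - 1)) (∑ j, derivMul j (V j)) N → ∀ j,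
        WeightedBound (besselWeight σ) (gradPart (fun k ↦ A ⋆ₘ V k) j) (ε * N + c * δ) := by
  have hd' : (3 : ℝ) ≤ d := by exact_mod_cast hd
  obtain ⟨c, hc⟩ := exists_gradPart_bounds hd hs hρ C
  obtain ⟨D, hD⟩ := WeightedBound.exists_interpolation (d := d) hσ hσs (by linarith) hε
  refine ⟨ε + D * c, fun α β A B v V G C' δ N h hv hN j ↦ ?_⟩
  have hbounds := hc _ _ _ _ _ _ _ _ _ h hv
  have hW := h.isFourierPair_mul hs hv
  have hdiv : WeightedBound (besselWeight (s - 1))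
      (∑ k, derivMul k (gradPart (fun k ↦ A ⋆ₘ V k) k)) (N + δ) :=
    (hN.sub (hv.div.anti (by linarith)) (by fun_prop)).congr
      (sum_derivMul_gradPart_ae_eq hv.field hW hv.weighted).symm
  have hcurl : ∀ i k, WeightedBound (besselWeight (s - 1))
      (derivMul i (gradPart (fun k ↦ A ⋆ₘ V k) k) - derivMul k (gradPart (fun k ↦ A ⋆ₘ V k) i))
      0 := fun i k ↦ by
    rw [derivMul_gradPart_comm, sub_self]
    exact ⟨aestronglyMeasurable_zero, by simp [weightedNorm]⟩
  have hgrad := WeightedBound.gradWeight_of_div_curl (fun k ↦ (hbounds k).1.1) hdiv hcurl j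
  rw [mul_zero, add_zero] at hgrad
  exact (hD _ _ _ hgrad (hbounds j).1).mono (le_of_eq (by ring))

/-- The Fourier transform of `∂ᵢ log (1 + β) = ∂ᵢ β + α ∂ᵢ β` when `(1 + α) (1 + β) = 1`. -/
def logDerivMul (i : Fin d) (A B : E d → ℂ) : E d → ℂ := derivMul i B + derivMul i B ⋆ₘ A

theorem exists_weightedBound_logDerivMul {a s : ℝ} (hs : (d : ℝ) / 2 < s) (ha : 0 ≤ a)
    (has : a ≤ s) :
    ∃ K : ℝ≥0, ∀ (A B : E d → ℂ) (C D : ℝ≥0), WeightedBound (besselWeight s) A C →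
      WeightedBound (besselWeight (a + 1)) B D → ∀ i,
        WeightedBound (besselWeight a) (logDerivMul i A B) ((1 + K * C) * D) := by
  obtain ⟨K, hK⟩ := (admissibleWeight_besselWeight (d := d) s).exists_weightedBound_convolution
    ha has hs
  refine ⟨K, fun A B C D hA hB i ↦ ?_⟩
  have hB' := hB.derivMul_of_besselWeight i
  exact (hB'.add (hK _ _ _ _ hB' hA) (by fun_prop)).mono (le_of_eq (by ring))

theorem InverseWeights.derivMul_convolution_ae_eq {s : ℝ} (hs : (d : ℝ) / 2 < s) {α β : E d → ℝ}
    {A B : E d → ℂ} {v V G : Fin d → E d → ℂ} {ρ C C' δ : ℝ≥0}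
    (h : InverseWeights s α β A B ρ C C') (hv : DivCurlBound s α v V G δ) (j : Fin d) :
    derivMul j B ⋆ₘ G j =ᵐ[volume] logDerivMul j A B ⋆ₘ V j := by
  have hs₀ : 0 ≤ s := le_trans (by positivity) hs.le
  obtain ⟨K, hK⟩ := exists_weightedBound_logDerivMul (d := d) hs hs₀ le_rfl
  obtain ⟨r, hr⟩ := hv.field_finite j
  obtain ⟨r', hr'⟩ := hv.weighted_finite j
  have hB := h.right_bound_succ.derivMul_of_besselWeight j
  obtain ⟨b, hb⟩ := IsFourierPair.exists_fourierInv (hB.memLp hs₀)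
  have hleft := hb.mul_of_weightedBound hs (hv.weighted j) hB (hr'.anti (by linarith))
  have hright := (hb.add (hb.mul_of_weightedBound hs h.left hB h.left_bound)).mul_of_weightedBound
    hs (hv.field j) (hK _ _ _ _ h.left_bound h.right_bound_succ j) (hr.anti (by linarith))
  refine (hleft.congr (.of_forall fun x ↦ ?_) ae_eq_rfl).unique hright
  simp only [Pi.add_apply, Pi.mul_apply, Complex.ofReal_add, Complex.ofReal_one]
  ring

theorem InverseWeights.derivMul_ae_eq {s : ℝ} (hs : (d : ℝ) / 2 < s) {α β : E d → ℝ}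
    {A B : E d → ℂ} {v V G : Fin d → E d → ℂ} {ρ C C' δ : ℝ≥0}
    (h : InverseWeights s α β A B ρ C C') (hv : DivCurlBound s α v V G δ) (j : Fin d) :
    derivMul j (V j) =ᵐ[volume]
      derivMul j (G j) + B ⋆ₘ derivMul j (G j) + logDerivMul j A B ⋆ₘ V j := by
  obtain ⟨r, hr⟩ := hv.weighted_finite j
  have hG : WeightedBound (besselWeight s) (G j) r := hr.anti (by linarith)
  have hfield : V j =ᵐ[volume] G j + B ⋆ₘ G j := by
    refine (hv.field j).unique (((hv.weighted j).add (h.right.mul_of_weightedBound hs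
      (hv.weighted j) h.right_bound hG)).congr (.of_forall fun x ↦ ?_) ae_eq_rfl)
    have hinv : (1 + α x : ℂ) * (1 + β x) = 1 := by exact_mod_cast h.mul_eq_one x
    simp only [Pi.add_apply, Pi.mul_apply, Complex.ofReal_add, Complex.ofReal_one]
    linear_combination v j x * hinv
  have hleibniz := derivMul_convolution j (integrable_of_besselWeight hs h.right_bound)
    (integrable_of_besselWeight hs hG)
    (integrable_of_besselWeight hs (h.right_bound_succ.derivMul_of_besselWeight j))
    (integrable_of_besselWeight hs (hr.derivMul_of_besselWeight j))
  filter_upwards [hfield, hleibniz, h.derivMul_convolution_ae_eq hs hv j] with ξ hV hB hlog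
  have hlin : derivMul j (V j) ξ = derivMul j (G j) ξ + derivMul j (B ⋆ₘ G j) ξ := by
    simp only [derivMul, hV, Pi.add_apply, mul_add]
  rw [hlin, hB]
  simp only [Pi.add_apply, hlog]
  ring

-- `div v = (1 + β) div g + ∇ log (1 + β) ⬝ v` for `g = (1 + α) v`.
theorem InverseWeights.sum_derivMul_ae_eq {s : ℝ} (hs : (d : ℝ) / 2 < s) {α β : E d → ℝ}
    {A B : E d → ℂ} {v V G : Fin d → E d → ℂ} {ρ C C' δ : ℝ≥0}
    (h : InverseWeights s α β A B ρ C C') (hv : DivCurlBound s α v V G δ) :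
    (∑ j, derivMul j (V j)) =ᵐ[volume] (∑ j, derivMul j (G j)) + B ⋆ₘ (∑ j, derivMul j (G j)) +
      ∑ j, logDerivMul j A B ⋆ₘ V j := by
  have hsum := convolution_sum_right Finset.univ (integrable_of_besselWeight hs h.right_bound)
    fun j _ ↦ (hv.weighted_finite j).elim fun r hr ↦
      integrable_of_besselWeight hs (hr.derivMul_of_besselWeight j)
  filter_upwards [ae_all_iff.2 (h.derivMul_ae_eq hs hv), hsum] with ξ hξ hsumξ
  simp only [Pi.add_apply] at hξ ⊢
  rw [hsumξ]
  simp only [Finset.sum_apply, hξ, Finset.sum_add_distrib]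

theorem exists_weightedBound_div {a s : ℝ} (hs : (d : ℝ) / 2 < s) (has : a ≤ s) (C : ℝ≥0) :
    ∃ c : ℝ≥0, ∀ (α β : E d → ℝ) (A B : E d → ℂ) (v V G : Fin d → E d → ℂ) (ρ C' δ N : ℝ≥0),
      InverseWeights s α β A B ρ C C' → DivCurlBound s α v V G δ →
      (∀ j, WeightedBound (besselWeight a) (logDerivMul j A B ⋆ₘ V j) N) →
        WeightedBound (besselWeight a) (∑ j, derivMul j (V j)) (c * δ + d * N) := by
  obtain ⟨K, hK⟩ := (admissibleWeight_besselWeight (d := d) s).exists_weightedBound_convolution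
    (le_trans (by positivity) hs.le) le_rfl hs
  refine ⟨1 + K * C, fun α β A B v V G ρ C' δ N h hv hN ↦ ?_⟩
  have hsum := WeightedBound.sum Finset.univ (fun j _ ↦ hN j) (measurable_besselWeight a)
  rw [Finset.sum_const, Finset.card_univ, Fintype.card_fin, nsmul_eq_mul] at hsum
  have hprod := (hK _ _ _ _ h.right_bound hv.div).anti has
  have hbound := ((hv.div.anti has).add hprod (by fun_prop)).add hsum (by fun_prop)
  exact (hbound.congr (h.sum_derivMul_ae_eq hs hv).symm).mono (by rw [add_mul, one_mul])

theorem exists_weightedBound_logDerivMul_convolution (hd : 3 ≤ d) {s : ℝ} (hs : (d : ℝ) / 2 < s)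
    {ρ ε : ℝ≥0} (hρ : 0 < ρ) (hε : 0 < ε) (C : ℝ≥0) :
    ∃ c : ℝ≥0, ∀ (α β : E d → ℝ) (A B : E d → ℂ) (v V G : Fin d → E d → ℂ) (C' δ N : ℝ≥0),
      InverseWeights s α β A B ρ C C' → DivCurlBound s α v V G δ →
      WeightedBound (besselWeight (s - 1)) (∑ j, derivMul j (V j)) N → ∀ j,
        WeightedBound (besselWeight (s - 1)) (logDerivMul j A B ⋆ₘ V j) (ε * N + c * δ) := by
  have hd' : (3 : ℝ) ≤ d := by exact_mod_cast hd
  obtain ⟨σ, hσ, hσs⟩ := exists_between (max_lt hs (sub_one_lt s))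
  rw [max_lt_iff] at hσ
  obtain ⟨K, hK⟩ := exists_weightedBound_logDerivMul (d := d) (a := s - 1) hs (by linarith)
    (by linarith)
  obtain ⟨K₁, hK₁⟩ := (admissibleWeight_gradWeight hd s).exists_weightedBound_convolution
    (a := s - 1) (by linarith) (by linarith) hs
  obtain ⟨K₂, hK₂⟩ := (admissibleWeight_besselWeight (d := d) σ).exists_weightedBound_convolution
    (a := s - 1) (by linarith) hσ.2.le hσ.1
  set q : ℝ≥0 := (1 + K * C) * C
  obtain ⟨c₁, hc₁⟩ := exists_gradPart_bounds hd hs hρ C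
  obtain ⟨c₂, hc₂⟩ := exists_gradPart_bound_interpolated hd (σ := σ) hs (by linarith) hσs hρ
    (ε := ε / (K₂ * q + 1)) (by positivity) C
  refine ⟨K₁ * q * c₁ + K₂ * q * c₂, fun α β A B v V G C' δ N h hv hN j ↦ ?_⟩
  have hlog := hK A B C C h.left_bound ((sub_add_cancel s 1).symm ▸ h.right_bound) j
  have hdiff := (hc₁ _ _ _ _ _ _ _ _ _ h hv j).2.gradWeight_anti (sub_one_lt s).le
  have hgrad := hc₂ _ _ _ _ _ _ _ _ _ _ h hv hN j
  have hlogInt : Integrable (logDerivMul j A B) := by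
    obtain ⟨K', hK'⟩ := exists_weightedBound_logDerivMul (d := d) hs (by linarith) le_rfl
    exact integrable_of_besselWeight hs (hK' A B C C' h.left_bound h.right_bound_succ j)
  have hsplit := convolution_add_right hlogInt
    (hdiff.integrable (admissibleWeight_gradWeight hd s) hs) (integrable_of_besselWeight hσ.1 hgrad)
  rw [sub_add_cancel] at hsplit
  have hεq : K₂ * q * (ε / (K₂ * q + 1)) ≤ ε := by
    rw [mul_div_left_comm]
    exact mul_le_of_le_one_right' (div_le_one_of_le₀ le_self_add zero_le)
  refine WeightedBound.congr (((hK₁ _ _ _ _ hlog hdiff).add (hK₂ _ _ _ _ hlog hgrad)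
    (by fun_prop)).mono ?_) hsplit.symm
  calc K₁ * q * (c₁ * δ) + K₂ * q * (ε / (K₂ * q + 1) * N + c₂ * δ)
      = K₂ * q * (ε / (K₂ * q + 1)) * N + (K₁ * q * c₁ + K₂ * q * c₂) * δ := by ring
    _ ≤ _ := by gcongr

theorem exists_weightedBound_div_sub_one (hd : 3 ≤ d) {s : ℝ} (hs : (d : ℝ) / 2 < s) {ρ : ℝ≥0}
    (hρ : 0 < ρ) (C : ℝ≥0) :
    ∃ c : ℝ≥0, ∀ (α β : E d → ℝ) (A B : E d → ℂ) (v V G : Fin d → E d → ℂ) (C' δ : ℝ≥0),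
      InverseWeights s α β A B ρ C C' → DivCurlBound s α v V G δ →
        WeightedBound (besselWeight (s - 1)) (∑ j, derivMul j (V j)) (c * δ) := by
  obtain ⟨c₁, hc₁⟩ := exists_weightedBound_div (d := d) (a := s - 1) hs (by linarith) C
  obtain ⟨c₂, hc₂⟩ := exists_weightedBound_logDerivMul_convolution hd hs hρ
    (ε := (2 * (d + 1) : ℝ≥0)⁻¹) (by positivity) C
  refine ⟨2 * (c₁ + d * c₂), fun α β A B v V G C' δ h hv ↦ ?_⟩
  set L := ∑ j, derivMul j (V j)
  obtain ⟨r, hr⟩ : ∃ r, WeightedBound (besselWeight (s - 1)) L r := by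
    choose r hr using hv.field_finite
    exact ⟨_, (WeightedBound.sum Finset.univ (fun j _ ↦ (hr j).derivMul_of_besselWeight j)
      (by fun_prop)).anti (by linarith)⟩
  have hL := weightedBound_of_memLp hr.1 (hr.memLp_mul (by fun_prop))
  set N := (weightedNorm (besselWeight (s - 1)) L).toNNReal
  have hbound := hc₁ _ _ _ _ _ _ _ _ _ _ _ h hv (hc₂ _ _ _ _ _ _ _ _ _ _ h hv hL)
  have hN : N ≤ c₁ * δ + d * ((2 * (d + 1) : ℝ≥0)⁻¹ * N + c₂ * δ) :=
    (ENNReal.toNNReal_mono ENNReal.coe_ne_top hbound.2).trans_eq (ENNReal.toNNReal_coe _)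
  have hhalf : (d : ℝ≥0) * (2 * (d + 1) : ℝ≥0)⁻¹ ≤ 1 / 2 := by
    rw [mul_inv, one_div, mul_left_comm, ← div_eq_mul_inv]
    exact mul_le_of_le_one_right' (div_le_one_of_le₀ le_self_add zero_le)
  refine hL.mono ?_
  have habsorb : N ≤ 1 / 2 * N + (c₁ + d * c₂) * δ := by
    calc N ≤ d * (2 * (d + 1) : ℝ≥0)⁻¹ * N + (c₁ + d * c₂) * δ := hN.trans_eq (by ring)
      _ ≤ _ := by gcongr
  rw [← NNReal.coe_le_coe] at habsorb ⊢
  push_cast at habsorb ⊢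
  linarith

theorem exists_weighted_div_curl (hd : 3 ≤ d) {s : ℝ} (hs : (d : ℝ) / 2 < s) {ρ : ℝ≥0}
    (hρ : 0 < ρ) (C : ℝ≥0) :
    ∃ c : ℝ≥0, ∀ (α β : E d → ℝ) (A B : E d → ℂ) (v V G : Fin d → E d → ℂ) (C' δ : ℝ≥0),
      InverseWeights s α β A B ρ C C' → DivCurlBound s α v V G δ → ∀ j,
        WeightedBound (gradWeight s) (V j) (c * (1 + C') * δ) := by
  have hs₀ : 0 ≤ s := le_trans (by positivity) hs.le
  obtain ⟨K, hK⟩ := exists_weightedBound_logDerivMul (d := d) hs hs₀ le_rfl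
  obtain ⟨K', hK'⟩ := (admissibleWeight_gradWeight hd s).exists_weightedBound_convolution
    hs₀ le_rfl hs
  obtain ⟨c₁, hc₁⟩ := exists_weightedBound_div_sub_one hd hs hρ C
  obtain ⟨c₂, hc₂⟩ := exists_weightedBound_div (d := d) hs le_rfl C
  set k : ℝ≥0 := d * (K' * (1 + K * C) * (c₁ + d)) with hk
  refine ⟨c₂ + k + d, fun α β A B v V G C' δ h hv j ↦ ?_⟩
  have hlow : ∀ i, WeightedBound (gradWeight (s - 1)) (V i) (c₁ * δ + d * δ) :=
    WeightedBound.gradWeight_of_div_curl (fun i ↦ (hv.field i).memLp_fourier.1)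
      (hc₁ _ _ _ _ _ _ _ _ _ h hv) fun i k ↦ (hv.curl i k).anti (by linarith)
  have hlog := hK A B C C' h.left_bound h.right_bound_succ
  have hdiv := hc₂ _ _ _ _ _ _ _ _ _ _ _ h hv fun i ↦ hK' _ _ _ _ (hlog i) (hlow i)
  refine (WeightedBound.gradWeight_of_div_curl (fun i ↦ (hv.field i).memLp_fourier.1)
    hdiv hv.curl j).mono ?_
  calc c₂ * δ + d * (K' * ((1 + K * C) * C') * (c₁ * δ + d * δ)) + d * δ
      = (c₂ + k * C' + d) * δ := by rw [hk]; ring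
    _ ≤ (c₂ + k * C' + d + (k + (c₂ + d) * C')) * δ := mul_le_mul_left le_self_add δ
    _ = (c₂ + k + d) * (1 + C') * δ := by ring

end WeightedDivCurl

section SobolevNorms

theorem sobolevNorm_nonneg (σ : ℝ) (u : 𝓢'(E d, ℂ)) : 0 ≤ sobolevNorm σ u := by
  unfold sobolevNorm
  split_ifs
  · exact norm_nonneg _
  · exact le_rfl

theorem normDiv_nonneg (σ : ℝ) (v : E d → E d) : 0 ≤ normDiv σ v := sobolevNorm_nonneg σ _

theorem normCurl_nonneg (σ : ℝ) (v : E d → E d) : 0 ≤ normCurl σ v := Real.sqrt_nonneg _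

theorem normGrad_nonneg (σ : ℝ) (v : E d → E d) : 0 ≤ normGrad σ v := Real.sqrt_nonneg _

theorem sobolevNorm_pd_le_normGrad (σ : ℝ) (v : E d → E d) (i j : Fin d) :
    sobolevNorm σ (pd v i j) ≤ normGrad σ v := by
  refine Real.le_sqrt_of_sq_le ?_
  calc sobolevNorm σ (pd v i j) ^ 2 ≤ ∑ j, sobolevNorm σ (pd v i j) ^ 2 :=
        Finset.single_le_sum (f := fun j ↦ sobolevNorm σ (pd v i j) ^ 2)
          (fun _ _ ↦ sq_nonneg _) (Finset.mem_univ j)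
    _ ≤ _ := Finset.single_le_sum (f := fun i ↦ ∑ j, sobolevNorm σ (pd v i j) ^ 2)
        (fun _ _ ↦ Finset.sum_nonneg fun _ _ ↦ sq_nonneg _) (Finset.mem_univ i)

theorem sobolevNorm_pd_sub_pd_le_normCurl (σ : ℝ) (v : E d → E d) {i j : Fin d} (hij : i < j) :
    sobolevNorm σ (pd v i j - pd v j i) ≤ normCurl σ v := by
  refine Real.le_sqrt_of_sq_le ?_
  calc sobolevNorm σ (pd v i j - pd v j i) ^ 2
      ≤ ∑ i ∈ Finset.univ.filter (· < j), sobolevNorm σ (pd v i j - pd v j i) ^ 2 :=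
        Finset.single_le_sum (f := fun i ↦ sobolevNorm σ (pd v i j - pd v j i) ^ 2)
          (fun _ _ ↦ sq_nonneg _) (by simpa using hij)
    _ ≤ _ := Finset.single_le_sum (f := fun j ↦ ∑ i ∈ Finset.univ.filter (· < j),
        sobolevNorm σ (pd v i j - pd v j i) ^ 2)
        (fun _ _ ↦ Finset.sum_nonneg fun _ _ ↦ sq_nonneg _) (Finset.mem_univ j)

theorem normGrad_le_of_forall_le {σ b : ℝ} {v : E d → E d} (hb : 0 ≤ b)
    (h : ∀ i j, sobolevNorm σ (pd v i j) ≤ b) : normGrad σ v ≤ d * b := by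
  refine Real.sqrt_le_iff.2 ⟨by positivity, ?_⟩
  calc ∑ i, ∑ j, sobolevNorm σ (pd v i j) ^ 2 ≤ ∑ _i : Fin d, ∑ _j : Fin d, b ^ 2 :=
        Finset.sum_le_sum fun i _ ↦ Finset.sum_le_sum fun j _ ↦
          pow_le_pow_left₀ (sobolevNorm_nonneg _ _) (h i j) 2
    _ = (d * b) ^ 2 := by
      simp only [Finset.sum_const, Finset.card_univ, Fintype.card_fin, nsmul_eq_mul]
      ring

theorem normGrad_eq_normDiv {σ : ℝ} (v : E 1 → E 1) : normGrad σ v = normDiv σ v := by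
  simp only [normGrad, normDiv, Finset.univ_unique, Finset.sum_singleton]
  exact Real.sqrt_sq (sobolevNorm_nonneg _ _)

variable {u : 𝓢'(E d, ℂ)} {f : E d → ℝ} {F : E d → ℂ} {σ : ℝ} {a : ℝ≥0}

theorem HasL2Fourier.sobolevNorm_eq_toNNReal (h : HasL2Fourier u F)
    (hF : WeightedBound (besselWeight σ) F a) :
    sobolevNorm σ u = (weightedNorm (besselWeight σ) F).toNNReal :=
  h.sobolevNorm_eq (hF.memLp_mul (by fun_prop))

theorem HasL2Fourier.sobolevNorm_le (h : HasL2Fourier u F)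
    (hF : WeightedBound (besselWeight σ) F a) : sobolevNorm σ u ≤ a := by
  rw [h.sobolevNorm_eq_toNNReal hF, NNReal.coe_le_coe]
  exact (ENNReal.toNNReal_mono ENNReal.coe_ne_top hF.2).trans_eq (ENNReal.toNNReal_coe _)

theorem HasL2Fourier.weightedBound (h : HasL2Fourier u F)
    (hF : WeightedBound (besselWeight σ) F a) :
    WeightedBound (besselWeight σ) F (sobolevNorm σ u).toNNReal := by
  rw [h.sobolevNorm_eq_toNNReal hF, Real.toNNReal_coe]
  exact weightedBound_of_memLp hF.1 (hF.memLp_mul (by fun_prop))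

theorem MemH.exists_isFourierPair (hf : MemH σ f) :
    ∃ F, IsFourierPair (fun x ↦ (f x : ℂ)) F ∧
      WeightedBound (besselWeight σ) F (normH σ f).toNNReal := by
  obtain ⟨F, hF⟩ := IsFourierPair.exists_fourier (f := fun x ↦ (f x : ℂ)) hf.1.ofReal
  exact ⟨F, hF, hF.hasL2Fourier.weightedBound (weightedBound_of_memLp hF.memLp_fourier.1
    (hF.hasL2Fourier.memSobolev_iff.1 hf.2))⟩

theorem IsFourierPair.memH (h : IsFourierPair (fun x ↦ (f x : ℂ)) F)
    (hF : WeightedBound (besselWeight σ) F a) : MemH σ f :=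
  ⟨by simpa using h.memLp.re, h.hasL2Fourier.memSobolev_iff.2 (hF.memLp_mul (by fun_prop))⟩

theorem IsFourierPair.weightedBound_normH (h : IsFourierPair (fun x ↦ (f x : ℂ)) F)
    (hf : MemH σ f) : WeightedBound (besselWeight σ) F (normH σ f).toNNReal := by
  obtain ⟨F', hF', hbound⟩ := hf.exists_isFourierPair
  exact hbound.congr (hF'.unique h)

theorem MemH.anti {σ' : ℝ} (hf : MemH σ f) (hσ : σ' ≤ σ) : MemH σ' f := by
  obtain ⟨F, hF, hbound⟩ := hf.exists_isFourierPair
  exact hF.memH (hbound.anti hσ)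

theorem MemH.normH_mono {σ' : ℝ} (hf : MemH σ f) (hσ : σ' ≤ σ) : normH σ' f ≤ normH σ f := by
  obtain ⟨F, hF, hbound⟩ := hf.exists_isFourierPair
  exact (hF.hasL2Fourier.sobolevNorm_le (hbound.anti hσ)).trans_eq
    (Real.coe_toNNReal _ (sobolevNorm_nonneg _ _))

theorem MemH.neg (hf : MemH σ f) : MemH σ fun x ↦ -f x := by
  obtain ⟨F, hF, hbound⟩ := hf.exists_isFourierPair
  exact (hF.neg.congr (.of_forall fun x ↦ (Complex.ofReal_neg _).symm) ae_eq_rfl).memH hbound.neg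

theorem MemH.normH_neg_le (hf : MemH σ f) : normH σ (fun x ↦ -f x) ≤ normH σ f := by
  obtain ⟨F, hF, hbound⟩ := hf.exists_isFourierPair
  have hneg : IsFourierPair (fun x ↦ ((-f x : ℝ) : ℂ)) (-F) :=
    hF.neg.congr (.of_forall fun x ↦ (Complex.ofReal_neg _).symm) ae_eq_rfl
  exact (hneg.hasL2Fourier.sobolevNorm_le hbound.neg).trans_eq
    (Real.coe_toNNReal _ (sobolevNorm_nonneg _ _))

end SobolevNorms

section VectorFields

variable {σ : ℝ} {v : E d → E d} {V : Fin d → E d → ℂ}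

theorem IsFourierPair.hasL2Fourier_lineDeriv {f F : E d → ℂ} {a : ℝ≥0} (hσ : 0 ≤ σ)
    (hf : IsFourierPair f F) (hF : WeightedBound (besselWeight (σ + 1)) F a) (i : Fin d) :
    HasL2Fourier (∂_{e i} (toDist f)) (derivMul i F) :=
  hf.hasL2Fourier.lineDeriv i ((hF.derivMul_of_besselWeight i).memLp hσ)

namespace VecMemH

theorem exists_isFourierPair (hv : VecMemH σ v) :
    ∃ V : Fin d → E d → ℂ, ∀ j, IsFourierPair (fun x ↦ (v x j : ℂ)) (V j) := by
  choose V hV _ using fun j ↦ (hv j).exists_isFourierPair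
  exact ⟨V, hV⟩

theorem hasL2Fourier_pd (hv : VecMemH (σ + 1) v)
    (hV : ∀ j, IsFourierPair (fun x ↦ (v x j : ℂ)) (V j)) (hσ : 0 ≤ σ) (i j : Fin d) :
    HasL2Fourier (pd v i j) (derivMul i (V j)) :=
  (hV j).hasL2Fourier_lineDeriv hσ ((hV j).weightedBound_normH (hv j)) i

theorem weightedBound_derivMul (hv : VecMemH (σ + 1) v)
    (hV : ∀ j, IsFourierPair (fun x ↦ (v x j : ℂ)) (V j)) (hσ : 0 ≤ σ) (i j : Fin d) :
    WeightedBound (besselWeight σ) (derivMul i (V j)) (normGrad σ v).toNNReal :=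
  ((hv.hasL2Fourier_pd hV hσ i j).weightedBound
    (((hV j).weightedBound_normH (hv j)).derivMul_of_besselWeight i)).mono
    (Real.toNNReal_mono (sobolevNorm_pd_le_normGrad σ v i j))

theorem weightedBound_div (hv : VecMemH (σ + 1) v)
    (hV : ∀ j, IsFourierPair (fun x ↦ (v x j : ℂ)) (V j)) (hσ : 0 ≤ σ) :
    WeightedBound (besselWeight σ) (∑ j, derivMul j (V j)) (normDiv σ v).toNNReal :=
  (HasL2Fourier.sum Finset.univ fun j _ ↦ hv.hasL2Fourier_pd hV hσ j j).weightedBound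
    (WeightedBound.sum Finset.univ (fun j _ ↦ hv.weightedBound_derivMul hV hσ j j) (by fun_prop))

theorem weightedBound_curl (hv : VecMemH (σ + 1) v)
    (hV : ∀ j, IsFourierPair (fun x ↦ (v x j : ℂ)) (V j)) (hσ : 0 ≤ σ) (i j : Fin d) :
    WeightedBound (besselWeight σ) (derivMul i (V j) - derivMul j (V i))
      (normCurl σ v).toNNReal := by
  have hbound : ∀ i j, i < j → WeightedBound (besselWeight σ)
      (derivMul i (V j) - derivMul j (V i)) (normCurl σ v).toNNReal := fun i j hij ↦
    (((hv.hasL2Fourier_pd hV hσ i j).sub (hv.hasL2Fourier_pd hV hσ j i)).weightedBound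
      ((hv.weightedBound_derivMul hV hσ i j).sub (hv.weightedBound_derivMul hV hσ j i)
        (by fun_prop))).mono (Real.toNNReal_mono (sobolevNorm_pd_sub_pd_le_normCurl σ v hij))
  rcases lt_trichotomy i j with hij | rfl | hij
  · exact hbound i j hij
  · rw [sub_self]
    exact ⟨aestronglyMeasurable_zero, by simp [weightedNorm]⟩
  · rw [← neg_sub]
    exact (hbound j i hij).neg

theorem weightedBound_gradWeight (hv : VecMemH (σ + 1) v)
    (hV : ∀ j, IsFourierPair (fun x ↦ (v x j : ℂ)) (V j)) (hσ : 0 ≤ σ) (j : Fin d) :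
    WeightedBound (gradWeight σ) (V j) ((d + d * 2) * (normGrad σ v).toNNReal) := by
  have hderiv := hv.weightedBound_derivMul hV hσ
  have hdiv := WeightedBound.sum Finset.univ (fun k _ ↦ hderiv k k) (by fun_prop)
  rw [Finset.sum_const, Finset.card_univ, Fintype.card_fin, nsmul_eq_mul] at hdiv
  refine (WeightedBound.gradWeight_of_div_curl (fun k ↦ (hV k).memLp_fourier.1) hdiv
    (fun i k ↦ (hderiv i k).sub (hderiv k i) (by fun_prop)) j).mono (le_of_eq (by ring))

theorem normGrad_le (hv : VecMemH (σ + 1) v)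
    (hV : ∀ j, IsFourierPair (fun x ↦ (v x j : ℂ)) (V j)) (hσ : 0 ≤ σ) {b : ℝ≥0}
    (h : ∀ i j, WeightedBound (besselWeight σ) (derivMul i (V j)) b) : normGrad σ v ≤ d * b :=
  normGrad_le_of_forall_le b.coe_nonneg fun i j ↦
    (hv.hasL2Fourier_pd hV hσ i j).sobolevNorm_le (h i j)

end VecMemH

end VectorFields

section ExponentialWeights

variable {s : ℝ} {φ : E d → ℝ} {v : E d → E d}

theorem weighted_neg_weighted (φ : E d → ℝ) (v : E d → E d) :
    weighted (fun x ↦ -φ x) (weighted φ v) = v := by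
  ext x : 1
  rw [weighted, weighted, smul_smul, ← Real.exp_add, neg_add_cancel, Real.exp_zero, one_smul]

theorem exists_inverseWeights_of_memH (hs : (d : ℝ) / 2 < s) (R : ℝ≥0) :
    ∃ C ρ : ℝ≥0, 0 < ρ ∧ ∀ φ : E d → ℝ, MemH (s + 1) φ → normH s φ ≤ R →
      ∃ A B, InverseWeights s (fun x ↦ Real.exp (φ x) - 1) (fun x ↦ Real.exp (-φ x) - 1) A B
        ρ C (C * (normH (s + 1) φ).toNNReal) := by
  obtain ⟨C, ρ, hρ, h⟩ := exists_inverseWeights_exp (d := d) hs R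
  refine ⟨C, ρ, hρ, fun φ hφ hR ↦ ?_⟩
  obtain ⟨Φ, hΦ, hbound⟩ := hφ.exists_isFourierPair
  exact h φ Φ _ hΦ ((hΦ.weightedBound_normH (hφ.anti (lt_add_one s).le)).mono
    (Real.toNNReal_le_iff_le_coe.2 hR)) hbound

theorem exists_exp_sub_one_of_memH (hs : (d : ℝ) / 2 < s) (R : ℝ≥0) :
    ∃ C : ℝ≥0, ∀ φ : E d → ℝ, MemH (s + 1) φ → normH (s + 1) φ ≤ R →
      ∃ A, IsFourierPair (fun x ↦ ((Real.exp (φ x) - 1 : ℝ) : ℂ)) A ∧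
        WeightedBound (besselWeight (s + 1)) A C := by
  obtain ⟨C, M, h⟩ := exists_exp_sub_one (d := d) hs R
  refine ⟨C * R, fun φ hφ hR ↦ ?_⟩
  obtain ⟨Φ, hΦ, hbound⟩ := hφ.exists_isFourierPair
  have hboundR := hbound.mono (Real.toNNReal_le_iff_le_coe.2 hR)
  obtain ⟨-, A, hA, -, hAC⟩ := h φ Φ R hΦ (hboundR.anti (lt_add_one s).le) hboundR
  exact ⟨A, hA, hAC⟩

theorem VecMemH.isFourierPair_weighted {A : E d → ℂ} {V : Fin d → E d → ℂ} {a : ℝ≥0}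
    (hv : VecMemH s v) (hs : (d : ℝ) / 2 < s)
    (hA : IsFourierPair (fun x ↦ ((Real.exp (φ x) - 1 : ℝ) : ℂ)) A)
    (hAa : WeightedBound (besselWeight s) A a)
    (hV : ∀ j, IsFourierPair (fun x ↦ (v x j : ℂ)) (V j)) (j : Fin d) :
    IsFourierPair (fun x ↦ (weighted φ v x j : ℂ)) (V j + A ⋆ₘ V j) := by
  refine ((hV j).add (hA.mul_of_weightedBound hs (hV j) hAa
    ((hV j).weightedBound_normH (hv j)))).congr (.of_forall fun x ↦ ?_) ae_eq_rfl
  simp only [Pi.add_apply, Pi.mul_apply, weighted, PiLp.smul_apply, smul_eq_mul,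
    Complex.ofReal_mul, Complex.ofReal_sub, Complex.ofReal_one]
  ring

theorem VecMemH.weighted (hs : (d : ℝ) / 2 < s) (hφ : MemH (s + 1) φ) (hv : VecMemH (s + 1) v) :
    VecMemH (s + 1) (weighted φ v) := by
  have hs₀ : 0 ≤ s := le_trans (by positivity) hs.le
  obtain ⟨C, hC⟩ := exists_exp_sub_one_of_memH (d := d) hs (normH (s + 1) φ).toNNReal
  obtain ⟨A, hA, hAC⟩ := hC φ hφ (Real.le_coe_toNNReal _)
  obtain ⟨V, hV⟩ := hv.exists_isFourierPair
  have hweight := admissibleWeight_besselWeight (d := d) (s + 1)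
  obtain ⟨K, hK⟩ := hweight.exists_weightedBound_convolution
    (a := s + 1) (by linarith) le_rfl (by linarith)
  intro j
  have hVj := (hV j).weightedBound_normH (hv j)
  exact (hv.isFourierPair_weighted (by linarith) hA hAC hV j).memH
    (hVj.add (hK _ _ _ _ hAC hVj) (by fun_prop))

theorem exists_weightedBound_derivMul_add_convolution (hd : 3 ≤ d) (hs : (d : ℝ) / 2 < s)
    (C : ℝ≥0) :
    ∃ c : ℝ≥0, ∀ (A F : E d → ℂ) (D r : ℝ≥0), WeightedBound (besselWeight (s + 1)) A C →
      WeightedBound (gradWeight s) F D → WeightedBound (besselWeight (s + 1)) F r → ∀ i,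
        WeightedBound (besselWeight s) (derivMul i (F + A ⋆ₘ F)) (c * D) := by
  have hs₀ : 0 ≤ s := le_trans (by positivity) hs.le
  obtain ⟨K, hK⟩ := (admissibleWeight_besselWeight (d := d) s).exists_weightedBound_convolution
    hs₀ le_rfl hs
  obtain ⟨K', hK'⟩ := (admissibleWeight_gradWeight hd s).exists_weightedBound_convolution
    hs₀ le_rfl hs
  refine ⟨1 + K' * C + K * C, fun A F D r hA hF hr i ↦ ?_⟩
  have hA' := hA.derivMul_of_besselWeight i
  have hF' := hF.derivMul_of_gradWeight i
  have hAs := hA.anti (lt_add_one s).le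
  have hleibniz := derivMul_convolution i (integrable_of_besselWeight hs hAs)
    (integrable_of_besselWeight hs (hr.anti (lt_add_one s).le)) (integrable_of_besselWeight hs hA')
    (integrable_of_besselWeight hs hF')
  have hbound := hF'.add ((hK' _ _ _ _ hA' (hF.gradWeight_anti (sub_one_lt s).le)).add
    (hK _ _ _ _ hAs hF') (by fun_prop)) (by fun_prop)
  refine (hbound.congr ?_).mono (le_of_eq (by ring))
  filter_upwards [hleibniz] with ξ hξ
  simp only [Pi.add_apply, derivMul, mul_add] at hξ ⊢
  rw [hξ]

theorem exists_normGrad_weighted_le (hd : 3 ≤ d) (hs : (d : ℝ) / 2 < s) (R : ℝ≥0) :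
    ∃ C : ℝ≥0, ∀ (φ : E d → ℝ) (v : E d → E d), MemH (s + 1) φ → VecMemH (s + 1) v →
      normH (s + 1) φ ≤ R → normGrad s (weighted φ v) ≤ C * normGrad s v := by
  have hs₀ : 0 ≤ s := le_trans (by positivity) hs.le
  obtain ⟨C, hC⟩ := exists_exp_sub_one_of_memH (d := d) hs R
  obtain ⟨c, hc⟩ := exists_weightedBound_derivMul_add_convolution hd hs C
  refine ⟨d * (c * (d + d * 2)), fun φ v hφ hv hR ↦ ?_⟩
  obtain ⟨A, hA, hAC⟩ := hC φ hφ hR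
  obtain ⟨V, hV⟩ := hv.exists_isFourierPair
  have hweighted := hv.isFourierPair_weighted (by linarith) hA hAC hV
  refine ((hv.weighted hs hφ).normGrad_le hweighted hs₀ fun i j ↦
    hc _ _ _ _ hAC (hv.weightedBound_gradWeight hV hs₀ j)
      ((hV j).weightedBound_normH (hv j)) i).trans_eq ?_
  push_cast
  rw [Real.coe_toNNReal _ (normGrad_nonneg s v)]
  ring

theorem VecMemH.divCurlBound (hs : (d : ℝ) / 2 < s) (hφ : MemH (s + 1) φ)
    (hv : VecMemH (s + 1) v) {V : Fin d → E d → ℂ}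
    (hV : ∀ j, IsFourierPair (fun x ↦ (v x j : ℂ)) (V j)) :
    ∃ G, DivCurlBound s (fun x ↦ Real.exp (φ x) - 1) (fun j x ↦ (v x j : ℂ)) V G
      ((normDiv s (WeightedFriedrichs.weighted φ v)).toNNReal + (normCurl s v).toNNReal) := by
  have hs₀ : 0 ≤ s := le_trans (by positivity) hs.le
  have hw := hv.weighted hs hφ
  obtain ⟨G, hG⟩ := hw.exists_isFourierPair
  refine ⟨G, hV, fun j ↦ (hG j).congr (.of_forall fun x ↦ ?_) ae_eq_rfl,
    fun j ↦ ⟨_, (hV j).weightedBound_normH (hv j)⟩, fun j ↦ ⟨_, (hG j).weightedBound_normH (hw j)⟩,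
    (hw.weightedBound_div hG hs₀).mono le_self_add,
    fun i j ↦ (hv.weightedBound_curl hV hs₀ i j).mono le_add_self⟩
  simp only [add_sub_cancel, WeightedFriedrichs.weighted, PiLp.smul_apply, smul_eq_mul,
    Complex.ofReal_mul]

theorem exists_normGrad_le_normDiv_weighted_add_normCurl (hd : 3 ≤ d) (hs : (d : ℝ) / 2 < s)
    (R : ℝ≥0) :
    ∃ C : ℝ≥0, ∀ (φ : E d → ℝ) (v : E d → E d), MemH (s + 1) φ → VecMemH (s + 1) v →
      normH s φ ≤ R → normGrad s v ≤
        (1 + normH (s + 1) φ) * C * (normDiv s (weighted φ v) + normCurl s v) := by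
  have hs₀ : 0 ≤ s := le_trans (by positivity) hs.le
  obtain ⟨C, ρ, hρ, hinv⟩ := exists_inverseWeights_of_memH (d := d) hs R
  obtain ⟨c, hc⟩ := exists_weighted_div_curl hd hs hρ C
  refine ⟨d * c * (1 + C), fun φ v hφ hv hR ↦ ?_⟩
  obtain ⟨A, B, hAB⟩ := hinv φ hφ hR
  obtain ⟨V, hV⟩ := hv.exists_isFourierPair
  obtain ⟨G, hG⟩ := hv.divCurlBound hs hφ hV
  refine (hv.normGrad_le hV hs₀ fun i j ↦
    (hc _ _ _ _ _ _ _ _ _ hAB hG j).derivMul_of_gradWeight i).trans ?_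
  have hφ₀ : 0 ≤ normH (s + 1) φ := sobolevNorm_nonneg _ _
  have hdiv := normDiv_nonneg s (weighted φ v)
  have hcurl := normCurl_nonneg s v
  push_cast
  rw [Real.coe_toNNReal _ hφ₀, Real.coe_toNNReal _ hdiv, Real.coe_toNNReal _ hcurl]
  have hC : 1 + C * normH (s + 1) φ ≤ (1 + C) * (1 + normH (s + 1) φ) := by
    linarith [C.coe_nonneg]
  calc d * (c * (1 + C * normH (s + 1) φ) * (normDiv s (weighted φ v) + normCurl s v))
      ≤ d * (c * ((1 + C) * (1 + normH (s + 1) φ)) *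
          (normDiv s (weighted φ v) + normCurl s v)) := by gcongr
    _ = _ := by ring

theorem exists_normGrad_le_normDiv_add_normCurl_weighted (hd : 3 ≤ d) (hs : (d : ℝ) / 2 < s)
    (R : ℝ≥0) :
    ∃ C : ℝ≥0, ∀ (φ : E d → ℝ) (v : E d → E d), MemH (s + 1) φ → VecMemH (s + 1) v →
      normH (s + 1) φ ≤ R → normGrad s v ≤ C * (normDiv s v + normCurl s (weighted φ v)) := by
  obtain ⟨C, hC⟩ := exists_normGrad_le_normDiv_weighted_add_normCurl hd hs R
  obtain ⟨C', hC'⟩ := exists_normGrad_weighted_le hd hs R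
  refine ⟨C' * ((1 + R) * C), fun φ v hφ hv hR ↦ ?_⟩
  have hw := hv.weighted hs hφ
  have hRneg := hφ.normH_neg_le.trans hR
  have hest := hC _ _ hφ.neg hw ((hφ.neg.normH_mono (lt_add_one s).le).trans hRneg)
  have hproduct := hC' _ _ hφ.neg hw hRneg
  rw [weighted_neg_weighted] at hest hproduct
  have hnonneg := add_nonneg (normDiv_nonneg s v) (normCurl_nonneg s (weighted φ v))
  calc normGrad s v ≤ C' * normGrad s (weighted φ v) := hproduct
    _ ≤ C' * ((1 + R) * C * (normDiv s v + normCurl s (weighted φ v))) := by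
      gcongr
      exact hest.trans (by gcongr)
    _ = _ := by push_cast; ring

theorem exists_isGradient_memLp_top (hs : (d : ℝ) / 2 < s) (hφ : MemH (s + 1) φ) :
    ∃ G, IsGradient φ G ∧ MemLp G ∞ volume := by
  have hs₀ : 0 ≤ s := le_trans (by positivity) hs.le
  obtain ⟨Φ, hΦ, hbound⟩ := hφ.exists_isFourierPair
  have hderiv := fun i ↦ hbound.derivMul_of_besselWeight i
  choose g hg using fun i ↦ IsFourierPair.exists_fourierInv ((hderiv i).memLp hs₀)
  refine ⟨fun x ↦ WithLp.toLp 2 fun i ↦ g i x,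
    ⟨MemLp.of_eval_piLp fun i ↦ (hg i).memLp, fun i ↦ ?_⟩, MemLp.of_eval_piLp fun i ↦ ?_⟩
  · obtain ⟨k, hk, hpartial⟩ := hΦ.hasL2Fourier_lineDeriv hs₀ hbound i
    rw [hpartial]
    exact (hg i).toDist_eq hk
  · exact memLp_top_of_bound (hg i).memLp.1 _
      ((hg i).ae_norm_le_integral_norm (integrable_of_besselWeight hs (hderiv i)))

theorem gradSup_lt_top (hs : (d : ℝ) / 2 < s) (hφ : MemH (s + 1) φ) : gradSup φ < ⊤ := by
  obtain ⟨G, hgrad, hG⟩ := exists_isGradient_memLp_top hs hφ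
  exact (iInf₂_le G hgrad).trans_lt hG.2

end ExponentialWeights

theorem exists_monotone_natCeil_le (f : ℕ → ℝ≥0) :
    ∃ g : ℝ → ℝ, Monotone g ∧ ∀ a, f ⌈a⌉₊ ≤ g a := by
  refine ⟨fun a ↦ ((∑ n ∈ Finset.range (⌈a⌉₊ + 1), f n : ℝ≥0) : ℝ), fun a b hab ↦ ?_, fun a ↦ ?_⟩
  · have hceil := Nat.ceil_mono hab
    exact NNReal.coe_le_coe.2 (Finset.sum_le_sum_of_subset (Finset.range_mono (by lia)))
  · exact NNReal.coe_le_coe.2 (Finset.single_le_sum_of_canonicallyOrdered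
      (Finset.self_mem_range_succ _))

end WeightedFriedrichs

end

open WeightedFriedrichs in
theorem mainTheorem6_general {d : ℕ} {s : ℝ} (hs : (d : ℝ) / 2 < s) :
    (3 ≤ d → ∃ 𝒞 : ℝ → ℝ, Monotone 𝒞 ∧
      ∀ (φ : E d → ℝ) (v : E d → E d), MemH (s + 1) φ → VecMemH (s + 1) v →
        gradSup φ < ⊤ ∧ VecMemH (s + 1) (weighted φ v) ∧
        normGrad s v ≤ (1 + normH (s + 1) φ) * 𝒞 (normH s φ) *
          (normDiv s (weighted φ v) + normCurl s v)) ∧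
    (d = 1 ∨ 3 ≤ d → ∃ 𝒞 : ℝ → ℝ, Monotone 𝒞 ∧
      ∀ (φ : E d → ℝ) (v : E d → E d), MemH (s + 1) φ → VecMemH (s + 1) v →
        VecMemH (s + 1) (weighted φ v) ∧
        normGrad s v ≤ 𝒞 (normH (s + 1) φ) * (normDiv s v + normCurl s (weighted φ v))) := by
  refine ⟨fun hd ↦ ?_, ?_⟩
  · choose C hC using fun n : ℕ ↦ exists_normGrad_le_normDiv_weighted_add_normCurl hd hs n
    obtain ⟨𝒞, hmono, h𝒞⟩ := exists_monotone_natCeil_le C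
    refine ⟨𝒞, hmono, fun φ v hφ hv ↦ ⟨gradSup_lt_top hs hφ, hv.weighted hs hφ,
      (hC _ φ v hφ hv (by exact_mod_cast Nat.le_ceil _)).trans ?_⟩⟩
    have hφ₀ : 0 ≤ normH (s + 1) φ := sobolevNorm_nonneg _ _
    have hnonneg := add_nonneg (normDiv_nonneg s (weighted φ v)) (normCurl_nonneg s v)
    gcongr
    exact h𝒞 _
  · rintro (rfl | hd)
    · refine ⟨fun _ ↦ 1, monotone_const, fun φ v hφ hv ↦ ⟨hv.weighted hs hφ, ?_⟩⟩
      rw [normGrad_eq_normDiv, one_mul]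
      exact le_add_of_nonneg_right (normCurl_nonneg _ _)
    · choose C hC using fun n : ℕ ↦ exists_normGrad_le_normDiv_add_normCurl_weighted hd hs n
      obtain ⟨𝒞, hmono, h𝒞⟩ := exists_monotone_natCeil_le C
      refine ⟨𝒞, hmono, fun φ v hφ hv ↦ ⟨hv.weighted hs hφ,
        (hC _ φ v hφ hv (by exact_mod_cast Nat.le_ceil _)).trans ?_⟩⟩
      have hnonneg := add_nonneg (normDiv_nonneg s v) (normCurl_nonneg s (weighted φ v))
      gcongr
      exact h𝒞 _

open WeightedFriedrichs in
theorem mainTheorem6 :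
    (∀ d s : ℕ, 3 ≤ d → (d : ℝ) / 2 < (s : ℝ) →
      ∃ 𝒞 : ℝ → ℝ → ℝ,
        (∀ a a' b b' : ℝ, 0 ≤ a → a ≤ a' → 0 ≤ b → b ≤ b' → 𝒞 a b ≤ 𝒞 a' b') ∧
        ∀ (φ : E d → ℝ) (v : E d → E d), MemH ((s : ℝ) + 1) φ → VecMemH ((s : ℝ) + 1) v →
          gradSup φ < ⊤ ∧ VecMemH ((s : ℝ) + 1) (weighted φ v) ∧
          normGrad (s : ℝ) v ≤
            (1 + normH ((s : ℝ) + 1) φ) * 𝒞 (normH (s : ℝ) φ) (gradSup φ).toReal *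
              (normDiv (s : ℝ) (weighted φ v) + normCurl (s : ℝ) v)) ∧
    (∀ d s : ℕ, (d = 1 ∨ 3 ≤ d) → (d : ℝ) / 2 < (s : ℝ) →
      ∃ 𝒞 : ℝ → ℝ,
        (∀ a a' : ℝ, 0 ≤ a → a ≤ a' → 𝒞 a ≤ 𝒞 a') ∧
        ∀ (φ : E d → ℝ) (v : E d → E d), MemH ((s : ℝ) + 1) φ → VecMemH ((s : ℝ) + 1) v →
          VecMemH ((s : ℝ) + 1) (weighted φ v) ∧
          normGrad (s : ℝ) v ≤
            𝒞 (normH ((s : ℝ) + 1) φ) *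
              (normDiv (s : ℝ) v + normCurl (s : ℝ) (weighted φ v))) := by
  refine ⟨fun d s hd hs ↦ ?_, fun d s hd hs ↦ ?_⟩
  · obtain ⟨𝒞, hmono, h𝒞⟩ := (mainTheorem6_general hs).1 hd
    exact ⟨fun a _ ↦ 𝒞 a, fun _ _ _ _ _ ha _ _ ↦ hmono ha, h𝒞⟩
  · obtain ⟨𝒞, hmono, h𝒞⟩ := (mainTheorem6_general hs).2 hd
    exact ⟨𝒞, fun _ _ _ ha ↦ hmono ha, h𝒞⟩
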